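/- Let $n\ge 2$ agents, with differentiable local costs $f_1,\dots,f_n:\mathbb R^d\to\mathbb R$, minimize $f=\frac1n\sum_{i=1}^n f_i$. Assume that $\|\nabla f_i(x)-\nabla f_i(y)\|\le \ell\|x-y\|$ for all $x,y$ and $i$, with $\ell>0$, and that $f^*=\inf_x f(x)>-\infty$. The agents communicate over an undirected connected graph with symmetric nonnegative weight matrix $A$ (agents $i\ne j$ are adjacent iff $A_{ij}>0$) and Laplacian $L=\mathrm{diag}(A\mathbf 1)-A$; let $\rho$ be the spectral radius and $\rho_2$ the smallest positive eigenvalue of $L$. Let $\mathcal C:\mathbb R^d\to\mathbb R^d$ be a (possibly randomized) compressor with $$\mathbb E_{\mathcal C}\Big[\Big\|\tfrac{\mathcal C(x)}{r}-x\Big\|^2\Big]\le(1-\delta)\|x\|^2+C\quad\text{for all }x\in\mathbb R^d,$$ where $r>0$, $C>0$, $\delta\in(0,1]$; its internal randomness is drawn afresh, independently of the past, at every iteration. Given $x_{i,0}\in\mathbb R^d$ and $v_{i,0}=\hat x_{i,-1}=y_{i,-1}=0$, the algorithm computes, for $k=0,1,\dots$ and each agent $i$, $$q_{i,k}=\mathcal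 C\big((x_{i,k}-\hat x_{i,k-1})/s_k\big),\quad \hat x_{i,k}=\hat x_{i,k-1}+\omega s_kq_{i,k},\quad y_{i,k}=y_{i,k-1}+\omega s_k\sum_{j=1}^nL_{ij}q_{j,k},$$ $$x_{i,k+1}=x_{i,k}-\alpha\big(\beta y_{i,k}+\gamma v_{i,k}+\nabla f_i(x_{i,k})\big),\quad v_{i,k+1}=v_{i,k}+\alpha\gamma y_{i,k}.$$ Let $\bar x_k=\frac1n\sum_i x_{i,k}$. Suppose that $$\tau_1\ge\kappa_1,\quad \gamma>\kappa_2,\quad \beta=\tau_1\gamma,\quad \omega\in(0,1/r],\quad \alpha\in(0,\hat\kappa_0'),$$ $$s_k=s_0\varepsilon^k,\quad \varepsilon\in(0,1),\quad s_0>0,\quad s_0\ge\max_i\|x_{i,0}\|_p\ \text{ for some } p\in[1,\infty],$$ where $$\kappa_1=\frac4{\rho_2},\qquad \kappa_2=\max\Big\{2+2\ell^2,\ \frac5{\rho_2},\ \sqrt[3]{\frac{16\ell^2(\kappa_1+1)^2}{\rho_2}},\ \frac{2\sqrt2\,\ell}{\rho_2}\Big\},$$ $$\hat\kappa_0'=\min\Big\{\frac{\varphi_1}{\varphi_2'},\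 \frac{\varphi_3}{\varphi_4'},\ \frac{\varphi_5}{\varphi_6},\ \frac{\sqrt{\varphi_7^2+8\varepsilon_{12}\varphi_8'}-\varphi_7}{2\varphi_8'}\Big\},$$ with $\varepsilon_9=\omega r\delta/2$, $\varepsilon_{10}=(1-2\varepsilon_9)(1+\varepsilon_9^{-1})$, $\varepsilon_{12}=(\varepsilon_9+2\varepsilon_9^2)/2$, and $$\varphi_1=\tfrac12\big(\rho_2\beta-(3\gamma+2+2\ell^2)\big),\qquad \varphi_2'=(3+4\varepsilon_{10})\rho^2\beta^2-\rho_2\beta\gamma+(\rho+2)\gamma^2+1+\big(\tfrac52+4\varepsilon_{10}\big)\ell^2,$$ $$\varphi_3=\frac\gamma2-\frac5{2\rho_2},\qquad \varphi_4'=(2+4\varepsilon_{10})\rho\gamma^2+\frac\rho2,\qquad \varphi_5=\frac18-\frac{(\beta+\gamma)^2\ell^2}{\gamma^5\rho_2}-\frac{\ell^2}{2\gamma^2\rho_2^2},$$ $$\varphi_6=\frac{(\beta+\gamma)\ell^2}{2\gamma^3\rho_2}+\frac{\ell^2}{2\gamma^2\rho_2^2}+\frac{\ell^2}{2\rho_2^2}+\frac{\ell^2}2+\frac\ell2,\qquad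 \varphi_7=(\rho+1)\gamma+\frac{\rho\beta}2,$$ $$\varphi_8'=(3+4\varepsilon_{10})\rho^2\beta^2+(\rho-2\rho_2)\beta\gamma+(\rho+2)\gamma^2+1.$$ Then, as $T\to\infty$, with all the expectations below finite, $$\frac1T\sum_{k=0}^{T-1}\mathbb E_{\mathcal C}\Big[\|\nabla f(\bar x_k)\|^2+\frac1n\sum_{i=1}^n\|x_{i,k}-\bar x_k\|^2\Big]=\mathcal O\Big(\frac1T\Big),\qquad \mathbb E_{\mathcal C}\big[f(\bar x_T)-f^*\big]=\mathcal O(1).$$ -/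

import Mathlib

open MeasureTheory ProbabilityTheory Filter Asymptotics
open scoped ENNReal

noncomputable section

namespace CompressedOpt

/-! ### Communication graph -/

/-- The undirected graph underlying a symmetric weighted adjacency matrix: two distinct agents are
joined when the weight between them is positive (a self-loop does not affect the Laplacian). -/
def supportGraph {n : ℕ} (A : Matrix (Fin n) (Fin n) ℝ) : SimpleGraph (Fin n) :=
  SimpleGraph.fromRel (fun i j => 0 < A i j)

/-- `A` is the weighted adjacency matrix of an undirected connected graph. -/
structure IsConnectedWeights {n : ℕ} (A : Matrix (Fin n) (Fin n) ℝ) : Prop where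
  nonneg : ∀ i j, 0 ≤ A i j
  symm : A.IsSymm
  connected : (supportGraph A).Connected

/-- The weighted Laplacian `L = D - A`, with `D` the diagonal matrix of the row sums of `A`. -/
def laplacian {n : ℕ} (A : Matrix (Fin n) (Fin n) ℝ) : Matrix (Fin n) (Fin n) ℝ :=
  Matrix.diagonal (fun i => ∑ j, A i j) - A

/-- The spectral radius `ρ(M)` of a real symmetric matrix, as a real number. -/
def rho {n : ℕ} (M : Matrix (Fin n) (Fin n) ℝ) : ℝ :=
  (spectralRadius ℝ M).toReal

/-- The smallest positive eigenvalue `ρ₂(M)` of a real symmetric matrix. -/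
def rhoTwo {n : ℕ} (M : Matrix (Fin n) (Fin n) ℝ) : ℝ :=
  sInf {μ : ℝ | 0 < μ ∧ μ ∈ spectrum ℝ M}

/-! ### Cost functions -/

/-- The average `n⁻¹ ∑ i, x i` of a family of vectors. -/
def avg {n d : ℕ} (x : Fin n → EuclideanSpace ℝ (Fin d)) : EuclideanSpace ℝ (Fin d) :=
  (n : ℝ)⁻¹ • ∑ i, x i

/-- The global cost `f = n⁻¹ ∑ i, f i`. -/
def globalCost {n d : ℕ} (f : Fin n → EuclideanSpace ℝ (Fin d) → ℝ)
    (x : EuclideanSpace ℝ (Fin d)) : ℝ :=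
  (n : ℝ)⁻¹ * ∑ i, f i x

/-- `g` is differentiable and its gradient is `ℓ`-Lipschitz. -/
def IsSmoothWith {d : ℕ} (ℓ : ℝ) (g : EuclideanSpace ℝ (Fin d) → ℝ) : Prop :=
  Differentiable ℝ g ∧ ∀ x y, ‖gradient g x - gradient g y‖ ≤ ℓ * ‖x - y‖

/-! ### Compressors -/

/-- A randomized compressor is a measurable map `𝒞 : Ξ → ℝᵈ → ℝᵈ`, whose first argument is its
internal randomness, of law `ν`. It is globally bounded with parameters `r`, `δ`, `C` if
`𝔼 ‖𝒞(x)/r - x‖² ≤ (1 - δ)‖x‖² + C` for every `x`. -/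
structure IsGloballyBounded {d : ℕ} {Ξ : Type*} [MeasurableSpace Ξ] (ν : Measure Ξ)
    (𝒞 : Ξ → EuclideanSpace ℝ (Fin d) → EuclideanSpace ℝ (Fin d)) (r δ C : ℝ) : Prop where
  measurable : Measurable (Function.uncurry 𝒞)
  integrable : ∀ x, Integrable (fun ζ => ‖r⁻¹ • 𝒞 ζ x - x‖ ^ 2) ν
  bound : ∀ x, ∫ ζ, ‖r⁻¹ • 𝒞 ζ x - x‖ ^ 2 ∂ν ≤ (1 - δ) * ‖x‖ ^ 2 + C

/-- The internal randomness used along a run of the algorithm: `ξ k i` is the one used by agent `i`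
at iteration `k`. Each has law `ν`, and different iterations are independent. Nothing is required
of the joint law of the agents within one iteration: their randomness may be independent or
shared. -/
structure IsFreshRandomness {n : ℕ} {Ω Ξ : Type*} [MeasurableSpace Ω] [MeasurableSpace Ξ]
    (μ : Measure Ω) (ν : Measure Ξ) (ξ : ℕ → Fin n → Ω → Ξ) : Prop where
  measurable : ∀ k i, Measurable (ξ k i)
  law : ∀ k i, μ.map (ξ k i) = ν
  indep : iIndepFun (fun k w i => ξ k i w) μ

/-! ### The algorithm -/

/-- The variables at the start of iteration `k`: `x = x_k`, `v = v_k`, `xhat = x̂_{k-1}`,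
`y = y_{k-1}`. -/
structure State (n d : ℕ) where
  x : Fin n → EuclideanSpace ℝ (Fin d)
  v : Fin n → EuclideanSpace ℝ (Fin d)
  xhat : Fin n → EuclideanSpace ℝ (Fin d)
  y : Fin n → EuclideanSpace ℝ (Fin d)

/-- The transmitted variables `q_{i,k} = 𝒞((x_{i,k} - x̂_{i,k-1}) / s_k)`, where `ζ i` is the
internal randomness of agent `i` in this iteration. -/
def message {n d : ℕ} {Ξ : Type*}
    (𝒞 : Ξ → EuclideanSpace ℝ (Fin d) → EuclideanSpace ℝ (Fin d))
    (s : ℝ) (ζ : Fin n → Ξ) (S : State n d) (i : Fin n) : EuclideanSpace ℝ (Fin d) :=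
  𝒞 (ζ i) (s⁻¹ • (S.x i - S.xhat i))

/-- The update `x̂_{i,k} = x̂_{i,k-1} + ω s_k q_{i,k}`. -/
def xhatUpdate {n d : ℕ} (ω s : ℝ) (q : Fin n → EuclideanSpace ℝ (Fin d)) (S : State n d)
    (i : Fin n) : EuclideanSpace ℝ (Fin d) :=
  S.xhat i + (ω * s) • q i

/-- The update `y_{i,k} = y_{i,k-1} + ω s_k ∑ j, L i j q_{j,k}`. -/
def yUpdate {n d : ℕ} (L : Matrix (Fin n) (Fin n) ℝ) (ω s : ℝ)
    (q : Fin n → EuclideanSpace ℝ (Fin d)) (S : State n d)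
    (i : Fin n) : EuclideanSpace ℝ (Fin d) :=
  S.y i + (ω * s) • ∑ j, L i j • q j

/-- One iteration, given the transmitted variables `q`. -/
def step {n d : ℕ} (L : Matrix (Fin n) (Fin n) ℝ) (f : Fin n → EuclideanSpace ℝ (Fin d) → ℝ)
    (α β γ ω s : ℝ) (q : Fin n → EuclideanSpace ℝ (Fin d)) (S : State n d) : State n d where
  x i := S.x i - α • (β • yUpdate L ω s q S i + γ • S.v i + gradient (f i) (S.x i))
  v i := S.v i + (α * γ) • yUpdate L ω s q S i
  xhat := xhatUpdate ω s q S
  y := yUpdate L ω s q S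

/-- The run of the algorithm from `x0` (all other variables start at `0`) along the realization
`ζ k i` of the internal randomness; `run … k` is the state at the start of iteration `k`. -/
def run {n d : ℕ} {Ξ : Type*} (L : Matrix (Fin n) (Fin n) ℝ)
    (f : Fin n → EuclideanSpace ℝ (Fin d) → ℝ)
    (𝒞 : Ξ → EuclideanSpace ℝ (Fin d) → EuclideanSpace ℝ (Fin d))
    (α β γ ω : ℝ) (s : ℕ → ℝ) (x0 : Fin n → EuclideanSpace ℝ (Fin d)) (ζ : ℕ → Fin n → Ξ) :
    ℕ → State n d
  | 0 => ⟨x0, 0, 0, 0⟩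
  | k + 1 =>
    let S := run L f 𝒞 α β γ ω s x0 ζ k
    step L f α β γ ω (s k) (message 𝒞 (s k) (ζ k) S) S

/-! ### Parameter thresholds

Below `ρ`, `ρ₂` stand for the spectral radius and the smallest positive eigenvalue of the
Laplacian. -/

def kappaOne (ρ₂ : ℝ) : ℝ := 4 / ρ₂

def kappaTwo (ρ₂ ℓ : ℝ) : ℝ :=
  max (max (2 + 2 * ℓ ^ 2) (5 / ρ₂))
    (max ((16 * ℓ ^ 2 * (kappaOne ρ₂ + 1) ^ 2 / ρ₂) ^ (1 / 3 : ℝ)) (2 * √2 * ℓ / ρ₂))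

def epsNine (ω r δ : ℝ) : ℝ := ω * r * δ / 2

def epsTen (ω r δ : ℝ) : ℝ := (1 - 2 * epsNine ω r δ) * (1 + (epsNine ω r δ)⁻¹)

def epsTwelve (ω r δ : ℝ) : ℝ := (epsNine ω r δ + 2 * epsNine ω r δ ^ 2) / 2

def phiOne (ρ₂ ℓ β γ : ℝ) : ℝ := (ρ₂ * β - (3 * γ + 2 + 2 * ℓ ^ 2)) / 2

def phiTwo' (ρ ρ₂ ℓ β γ ε₁₀ : ℝ) : ℝ :=
  (3 + 4 * ε₁₀) * ρ ^ 2 * β ^ 2 - ρ₂ * β * γ + (ρ + 2) * γ ^ 2 + 1 + (5 / 2 + 4 * ε₁₀) * ℓ ^ 2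

def phiThree (ρ₂ γ : ℝ) : ℝ := γ / 2 - 5 / 2 * ρ₂⁻¹

def phiFour' (ρ γ ε₁₀ : ℝ) : ℝ := (2 + 4 * ε₁₀) * ρ * γ ^ 2 + ρ / 2

def phiFive (ρ₂ ℓ β γ : ℝ) : ℝ :=
  1 / 8 - (β + γ) ^ 2 / γ ^ 5 * ρ₂⁻¹ * ℓ ^ 2 - 1 / (2 * γ ^ 2) * (ρ₂ ^ 2)⁻¹ * ℓ ^ 2

def phiSix (ρ₂ ℓ β γ : ℝ) : ℝ :=
  (β + γ) / (2 * γ ^ 3) * ρ₂⁻¹ * ℓ ^ 2 + 1 / (2 * γ ^ 2) * (ρ₂ ^ 2)⁻¹ * ℓ ^ 2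
    + (ρ₂ ^ 2)⁻¹ / 2 * ℓ ^ 2 + ℓ ^ 2 / 2 + ℓ / 2

def phiSeven (ρ β γ : ℝ) : ℝ := (ρ + 1) * γ + ρ * β / 2

def phiEight' (ρ ρ₂ β γ ε₁₀ : ℝ) : ℝ :=
  (3 + 4 * ε₁₀) * ρ ^ 2 * β ^ 2 + (ρ - 2 * ρ₂) * β * γ + (ρ + 2) * γ ^ 2 + 1

/-- The upper bound on the stepsize `α`. -/
def stepsizeBound (ρ ρ₂ ℓ β γ ω r δ : ℝ) : ℝ :=
  let ε₁₀ := epsTen ω r δ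
  let ε₁₂ := epsTwelve ω r δ
  let φ₇ := phiSeven ρ β γ
  let φ₈ := phiEight' ρ ρ₂ β γ ε₁₀
  min (min (phiOne ρ₂ ℓ β γ / phiTwo' ρ ρ₂ ℓ β γ ε₁₀) (phiThree ρ₂ γ / phiFour' ρ γ ε₁₀))
    (min (phiFive ρ₂ ℓ β γ / phiSix ρ₂ ℓ β γ) ((√(φ₇ ^ 2 + 8 * ε₁₂ * φ₈) - φ₇) / (2 * φ₈)))

end CompressedOpt

end

/-! Let `x̂_k` be the estimates after the compressor has acted in iteration `k`. Since `y_k = L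
x̂_k`, the algorithm is a primal-dual gradient method in which the Laplacian acts on `x̂_k` instead
of `x_k`. Expand in an orthonormal eigenbasis of `L`. For an eigenvalue `l > 0` the state is a pair:
`u`, the coefficient of `x`, and `w`, the coefficient of `v + γ⁻¹ ∇f_i(x̄)`, which measures how far
the dual variable is from balancing the gradients. The form `modeEnergy` is weighted so that the
first-order terms in `⟨u, w⟩` cancel while its cross term damps `w`. The kernel of `L` consists of
the constant vectors; there the algorithm is gradient descent on `f` with an inexact gradient, and
the descent lemma applies.

Adding both parts gives `lyapunov_step_le`: along every realization the Lyapunov function loses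
multiples of the consensus error and of `‖∇f(x̄)‖²`, also pays for `c ‖x_{k+1} - x_k‖²`, and gains
at most `κ` times the compression error `‖x_k - x̂_k‖²`.

In expectation one compression contracts the error by `1 - ωrδ`, up to `O(s_k²)`
(`IsGloballyBounded.integral_error_le`), but `x` has moved since the last one. Young's inequality
with weight `ε₉` turns this into a factor `1 - 2ε₁₂` on the old error plus `ε₁₀` times the squared
move. Taking `c = ε₁₀` cancels the move, and the stepsize bound ensures `κ ≤ 2ε₁₂`
(`coefficients_of_lt_stepsizeBound`). Hence `potential` decreases up to a geometric, thus summable,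
term (`potential_step_le`), and telescoping bounds the total dissipation and `f(x̄_T) - f*`
together. -/

namespace CompressedOpt

/-! ### Energy of a single Laplacian eigenspace -/

section Mode

variable {E : Type*} [NormedAddCommGroup E] [InnerProductSpace ℝ E]

/-- The contribution of one Laplacian eigenspace, of eigenvalue `l`, to the Lyapunov function. -/
noncomputable def modeEnergy (β γ l : ℝ) (u w : E) : ℝ :=
  1 / 2 * ‖u‖ ^ 2 + (β + γ) / (2 * γ * l) * ‖w‖ ^ 2 + l⁻¹ * inner ℝ u w

theorem inner_le_weighted (c : ℝ) (hc : 0 < c) (x y : E) :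
    inner ℝ x y ≤ c / 2 * ‖x‖ ^ 2 + 1 / (2 * c) * ‖y‖ ^ 2 := by
  have h : 0 ≤ ‖c • x - y‖ ^ 2 := sq_nonneg _
  rw [norm_sub_sq_real, norm_smul, inner_smul_left, mul_pow, Real.norm_eq_abs, sq_abs] at h
  simp only [RCLike.conj_to_real] at h
  have : c / 2 * ‖x‖ ^ 2 + 1 / (2 * c) * ‖y‖ ^ 2 - inner ℝ x y
      = 1 / (2 * c) * (c ^ 2 * ‖x‖ ^ 2 - 2 * (c * inner ℝ x y) + ‖y‖ ^ 2) := by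
    field_simp
    ring
  have h2 : 0 ≤ 1 / (2 * c) * (c ^ 2 * ‖x‖ ^ 2 - 2 * (c * inner ℝ x y) + ‖y‖ ^ 2) := by positivity
  linarith

theorem neg_inner_le_weighted (c : ℝ) (hc : 0 < c) (x y : E) :
    -inner ℝ x y ≤ c / 2 * ‖x‖ ^ 2 + 1 / (2 * c) * ‖y‖ ^ 2 := by
  have := inner_le_weighted c hc x (-y)
  rwa [inner_neg_right, norm_neg] at this

theorem norm_sub_sq_le_two (x y : E) : ‖x - y‖ ^ 2 ≤ 2 * ‖x‖ ^ 2 + 2 * ‖y‖ ^ 2 := by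
  have := parallelogram_law_with_norm ℝ x y
  nlinarith [sq_nonneg ‖x + y‖]

theorem norm_add_sq_le_two (x y : E) : ‖x + y‖ ^ 2 ≤ 2 * ‖x‖ ^ 2 + 2 * ‖y‖ ^ 2 := by
  have := norm_sub_sq_le_two x (-y)
  rwa [sub_neg_eq_add, norm_neg] at this

/-- Young's inequality with weight `l` uses up the `u` term exactly and asks for `1 / (2 * l ^ 2)`
of `‖w‖ ^ 2`, which the `w` term covers once `γ ≤ l * β`. -/
theorem modeEnergy_nonneg {β γ l : ℝ} (hγ : 0 < γ) (hl : 0 < l) (h : γ ≤ l * β) (u w : E) :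
    0 ≤ modeEnergy β γ l u w := by
  have h1 := neg_inner_le_weighted l hl u w
  have h2 : -(l⁻¹ * inner ℝ u w) ≤ 1 / 2 * ‖u‖ ^ 2 + 1 / (2 * l ^ 2) * ‖w‖ ^ 2 := by
    have := mul_le_mul_of_nonneg_left h1 (inv_nonneg.2 hl.le)
    calc _ = l⁻¹ * -inner ℝ u w := by ring
      _ ≤ _ := this
      _ = _ := by field_simp
  have h3 : 1 / (2 * l ^ 2) ≤ (β + γ) / (2 * γ * l) := by
    rw [div_le_div_iff₀ (by positivity) (by positivity)]
    nlinarith [mul_pos hl hl, mul_pos hγ hl, mul_le_mul_of_nonneg_left h hl.le]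
  have := mul_le_mul_of_nonneg_right h3 (sq_nonneg ‖w‖)
  unfold modeEnergy
  linarith

/-- At first order in `α` the three parts of the energy contribute `-γ`, `β + γ` and `-β` to `⟨u,
w⟩`, so this product disappears, and the cross term of the energy yields the damping `-α * γ / l *
‖w‖ ^ 2`. The `α ^ 2` terms without `Δ` are grouped by completing the square. -/
theorem modeEnergy_step_eq {α β γ l : ℝ} (hγ : γ ≠ 0) (hl : l ≠ 0) (u w e a Δ : E) :
    modeEnergy β γ l (u - α • ((β * l) • (u - e) + γ • w + a))
        (w + (α * γ * l) • (u - e) + γ⁻¹ • Δ)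
      = modeEnergy β γ l u w
        - α * β * l * ‖u‖ ^ 2 + α * γ * ‖u‖ ^ 2 - α * γ / l * ‖w‖ ^ 2
        + α * β * l * inner ℝ u e - α * γ * inner ℝ u e - α * γ * inner ℝ e w
        - α * inner ℝ u a - α / l * inner ℝ a w
        + 1 / (γ * l) * inner ℝ u Δ + (β + γ) / (γ ^ 2 * l) * inner ℝ w Δ
        + α ^ 2 * (1 / 2 * ‖(β * l - γ) • (u - e) + (γ • w + a)‖ ^ 2
          - 1 / 2 * γ ^ 2 * ‖u - e‖ ^ 2 + 1 / 2 * (β + γ) * γ * l * ‖u - e‖ ^ 2)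
        + α * inner ℝ (u - e) Δ - α / l * inner ℝ w Δ - α / (γ * l) * inner ℝ a Δ
        + (β + γ) / (2 * γ ^ 3 * l) * ‖Δ‖ ^ 2 := by
  unfold modeEnergy
  simp only [← real_inner_self_eq_norm_sq, inner_add_left, inner_add_right, inner_sub_left,
    inner_sub_right, inner_smul_left, inner_smul_right, RCLike.conj_to_real]
  rw [real_inner_comm u e, real_inner_comm u w, real_inner_comm u a, real_inner_comm u Δ,
    real_inner_comm w e, real_inner_comm w a, real_inner_comm w Δ, real_inner_comm e a,
    real_inner_comm e Δ]
  field_simp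
  ring

theorem norm_add_add_sq_le (x y z : E) :
    ‖x + (y + z)‖ ^ 2 ≤ 2 * ‖x‖ ^ 2 + 4 * ‖y‖ ^ 2 + 4 * ‖z‖ ^ 2 := by
  linarith [norm_add_sq_le_two x (y + z), norm_add_sq_le_two y z]

theorem norm_smul_sq (c : ℝ) (x : E) : ‖c • x‖ ^ 2 = c ^ 2 * ‖x‖ ^ 2 := by
  rw [norm_smul, mul_pow, Real.norm_eq_abs, sq_abs]

theorem norm_direction_sq_le (β γ l : ℝ) (u w e a : E) :
    ‖(β * l) • (u - e) + γ • w + a‖ ^ 2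
      ≤ 4 * (β * l) ^ 2 * ‖u‖ ^ 2 + 4 * (β * l) ^ 2 * ‖e‖ ^ 2 + 4 * γ ^ 2 * ‖w‖ ^ 2
        + 4 * ‖a‖ ^ 2 := by
  have h1 := norm_add_add_sq_le ((β * l) • (u - e)) (γ • w) a
  have h2 := mul_le_mul_of_nonneg_left (norm_sub_sq_le_two u e) (sq_nonneg (β * l))
  rw [norm_smul_sq, norm_smul_sq] at h1
  rw [add_assoc]
  linarith

/-- One-step change of the energy of an eigenspace, all cross terms being split by Young's
inequality. -/
theorem modeEnergy_step_le_of_eigenvalue {α β γ l l₂ : ℝ} (hα : 0 < α) (hγ : 0 < γ) (hl₂ : 0 < l₂)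
    (hl : l₂ ≤ l) (hβ : 4 * γ ≤ l₂ * β) (u w e a Δ : E) :
    modeEnergy β γ l (u - α • ((β * l) • (u - e) + γ • w + a))
        (w + (α * γ * l) • (u - e) + γ⁻¹ • Δ)
      ≤ modeEnergy β γ l u w
        + (-(α * (β * l - 3 * γ - 2) / 2) + α ^ 2 * (2 * (β * l) ^ 2 - 3 * (β * l) * γ + γ ^ 2
          + γ ^ 2 * l + 1)) * ‖u‖ ^ 2
        + (-(α * (γ / 2 - 1 / (2 * l₂))) + α ^ 2 * (2 * γ ^ 2 * l + l / 2)) / l * ‖w‖ ^ 2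
        + (α * (β * l / 2 + γ / 2 + γ * l) + α ^ 2 * (2 * (β * l) ^ 2 - 3 * (β * l) * γ + γ ^ 2
          + γ ^ 2 * l + 1)) * ‖e‖ ^ 2
        + (α + α ^ 2 * (5 / 2)) * ‖a‖ ^ 2
        + (1 / α * (1 / (2 * γ ^ 2 * l ^ 2) + (β + γ) ^ 2 / (γ ^ 5 * l))
          + (1 / 2 + 1 / (2 * l ^ 2) + 1 / (2 * γ ^ 2 * l ^ 2) + (β + γ) / (2 * γ ^ 3 * l)))
            * ‖Δ‖ ^ 2 := by
  have hl0 : 0 < l := hl₂.trans_le hl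
  have hβ0 : 0 < β := by
    by_contra h
    nlinarith [mul_nonneg hl₂.le (neg_nonneg.2 (not_lt.1 h))]
  rw [modeEnergy_step_eq hγ.ne' hl0.ne']
  have e1 : α * β * l * inner ℝ u e ≤ α * β * l * (1 / 2 * ‖u‖ ^ 2 + 1 / (2 * 1) * ‖e‖ ^ 2) :=
    mul_le_mul_of_nonneg_left (inner_le_weighted 1 one_pos u e) (by positivity)
  have e2 : α * γ * -inner ℝ u e ≤ α * γ * (1 / 2 * ‖u‖ ^ 2 + 1 / (2 * 1) * ‖e‖ ^ 2) :=
    mul_le_mul_of_nonneg_left (neg_inner_le_weighted 1 one_pos u e) (by positivity)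
  -- The weights in `e3` and `e7` each spend a quarter of the damping `α * γ / l * ‖w‖ ^ 2`; half of
  -- it remains, less the part used by `e5`.
  have e3 : α * γ * -inner ℝ e w ≤ α * γ * (2 * l / 2 * ‖e‖ ^ 2 + 1 / (2 * (2 * l)) * ‖w‖ ^ 2) :=
    mul_le_mul_of_nonneg_left (neg_inner_le_weighted (2 * l) (by positivity) e w) (by positivity)
  have e4 : α * -inner ℝ u a ≤ α * (1 / 2 * ‖u‖ ^ 2 + 1 / (2 * 1) * ‖a‖ ^ 2) :=
    mul_le_mul_of_nonneg_left (neg_inner_le_weighted 1 one_pos u a) hα.le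
  have e5 : α / l * -inner ℝ a w ≤ α * (1 / 2 * ‖a‖ ^ 2 + 1 / (2 * l₂ * l) * ‖w‖ ^ 2) := by
    have h := mul_le_mul_of_nonneg_left (neg_inner_le_weighted l₂ hl₂ a w)
      (by positivity : 0 ≤ α / l)
    have h2 : l₂ / l ≤ 1 := (div_le_one hl0).2 hl
    have h3 := mul_le_mul_of_nonneg_right h2 (by positivity : 0 ≤ α / 2 * ‖a‖ ^ 2)
    calc _ ≤ _ := h
      _ = l₂ / l * (α / 2 * ‖a‖ ^ 2) + α * (1 / (2 * l₂ * l) * ‖w‖ ^ 2) := by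
        field_simp
      _ ≤ _ := by linarith
  -- The products with `Δ` in `e6` and `e7` carry no factor `α`. Weights proportional to `α` leave
  -- `‖Δ‖ ^ 2 / α`, which is harmless because `Δ` will be of order `α`.
  have e6 : 1 / (γ * l) * inner ℝ u Δ
      ≤ α / 2 * ‖u‖ ^ 2 + 1 / α * (1 / (2 * γ ^ 2 * l ^ 2)) * ‖Δ‖ ^ 2 := by
    have h := mul_le_mul_of_nonneg_left (inner_le_weighted (α * γ * l) (by positivity) u Δ)
      (by positivity : 0 ≤ 1 / (γ * l))
    refine h.trans_eq ?_
    field_simp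
  have e7 : (β + γ) / (γ ^ 2 * l) * inner ℝ w Δ
      ≤ α * γ / (4 * l) * ‖w‖ ^ 2 + 1 / α * ((β + γ) ^ 2 / (γ ^ 5 * l)) * ‖Δ‖ ^ 2 := by
    have h := mul_le_mul_of_nonneg_left
      (inner_le_weighted (α * γ ^ 3 / (2 * (β + γ))) (by positivity) w Δ)
      (by positivity : 0 ≤ (β + γ) / (γ ^ 2 * l))
    refine h.trans_eq ?_
    field_simp
    ring
  have e8 := norm_add_add_sq_le ((β * l - γ) • (u - e)) (γ • w) a
  rw [norm_smul_sq, norm_smul_sq] at e8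
  have e9 := norm_sub_sq_le_two u e
  have e10 : α ^ 2 * (1 / 2 * ‖(β * l - γ) • (u - e) + (γ • w + a)‖ ^ 2
          - 1 / 2 * γ ^ 2 * ‖u - e‖ ^ 2 + 1 / 2 * (β + γ) * γ * l * ‖u - e‖ ^ 2)
      ≤ α ^ 2 * ((2 * (β * l) ^ 2 - 3 * (β * l) * γ + γ ^ 2 + γ ^ 2 * l) * (‖u‖ ^ 2 + ‖e‖ ^ 2)
        + 2 * γ ^ 2 * ‖w‖ ^ 2 + 2 * ‖a‖ ^ 2) := by
    refine mul_le_mul_of_nonneg_left ?_ (sq_nonneg α)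
    have hbl : 4 * γ ≤ β * l := by nlinarith [mul_le_mul_of_nonneg_right hl hβ0.le]
    have hc : 0 ≤ (β * l - γ) ^ 2 - 1 / 2 * γ ^ 2 + 1 / 2 * (β + γ) * γ * l := by
      have : 0 ≤ (β + γ) * γ * l := by positivity
      nlinarith [sq_nonneg γ]
    have := mul_le_mul_of_nonneg_left e9 hc
    linarith
  have e11 : α * inner ℝ (u - e) Δ ≤ α ^ 2 * (‖u‖ ^ 2 + ‖e‖ ^ 2) + 1 / 2 * ‖Δ‖ ^ 2 := by
    have h := mul_le_mul_of_nonneg_left (inner_le_weighted α hα (u - e) Δ) hα.le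
    have h2 := mul_le_mul_of_nonneg_left e9 (by positivity : 0 ≤ α ^ 2 / 2)
    calc _ ≤ _ := h
      _ = α ^ 2 / 2 * ‖u - e‖ ^ 2 + 1 / 2 * ‖Δ‖ ^ 2 := by field_simp
      _ ≤ _ := by linarith
  have e12 : α / l * -inner ℝ w Δ ≤ α ^ 2 / 2 * ‖w‖ ^ 2 + 1 / (2 * l ^ 2) * ‖Δ‖ ^ 2 := by
    have h := mul_le_mul_of_nonneg_left (neg_inner_le_weighted (α * l) (by positivity) w Δ)
      (by positivity : 0 ≤ α / l)
    refine h.trans_eq ?_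
    field_simp
  have e13 : α / (γ * l) * -inner ℝ a Δ
      ≤ α ^ 2 / 2 * ‖a‖ ^ 2 + 1 / (2 * γ ^ 2 * l ^ 2) * ‖Δ‖ ^ 2 := by
    have h := mul_le_mul_of_nonneg_left (neg_inner_le_weighted (α * γ * l) (by positivity) a Δ)
      (by positivity : 0 ≤ α / (γ * l))
    refine h.trans_eq ?_
    field_simp
  have e14 : (-(α * (γ / 2 - 1 / (2 * l₂))) + α ^ 2 * (2 * γ ^ 2 * l + l / 2)) / l * ‖w‖ ^ 2
      = - α * γ / l * ‖w‖ ^ 2 + α * γ * (1 / (2 * (2 * l)) * ‖w‖ ^ 2)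
        + α * (1 / (2 * l₂ * l) * ‖w‖ ^ 2) + α * γ / (4 * l) * ‖w‖ ^ 2
        + α ^ 2 * (2 * γ ^ 2 * ‖w‖ ^ 2) + α ^ 2 / 2 * ‖w‖ ^ 2 := by
    field_simp
    ring
  rw [e14]
  linear_combination e1 + e2 + e3 + e4 + e5 + e6 + e7 + e10 + e11 + e12 + e13

/-- Bounds uniform over `l₂ ≤ l ≤ ρ` make it possible to sum over the modes; only the `w` term keeps
its `1 / l`, since just its sign matters later. Charging `c` times the squared move produces the `4
* c` in the coefficients. -/
theorem modeEnergy_step_le {α β γ l l₂ ρ c : ℝ} (hα : 0 < α) (hγ : 0 < γ) (hl₂ : 0 < l₂)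
    (hl : l₂ ≤ l) (hlρ : l ≤ ρ) (hβ : 4 * γ ≤ l₂ * β) (hc : 0 ≤ c) (u w e a Δ : E) :
    modeEnergy β γ l (u - α • ((β * l) • (u - e) + γ • w + a))
        (w + (α * γ * l) • (u - e) + γ⁻¹ • Δ)
        + c * ‖α • ((β * l) • (u - e) + γ • w + a)‖ ^ 2
      ≤ modeEnergy β γ l u w
        - (α * ((l₂ * β - 3 * γ - 2) / 2) - α ^ 2 * ((3 + 4 * c) * ρ ^ 2 * β ^ 2 - l₂ * β * γ
          + (ρ + 2) * γ ^ 2 + 1)) * ‖u‖ ^ 2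
        - (α * phiThree l₂ γ - α ^ 2 * phiFour' ρ γ c) / l * ‖w‖ ^ 2
        + (α * phiSeven ρ β γ + α ^ 2 * phiEight' ρ l₂ β γ c) * ‖e‖ ^ 2
        + (α + α ^ 2 * (5 / 2 + 4 * c)) * ‖a‖ ^ 2
        + (1 / α * (1 / (2 * γ ^ 2) * (l₂ ^ 2)⁻¹ + (β + γ) ^ 2 / γ ^ 5 * l₂⁻¹)
          + (1 / 2 + (l₂ ^ 2)⁻¹ / 2 + 1 / (2 * γ ^ 2) * (l₂ ^ 2)⁻¹
            + (β + γ) / (2 * γ ^ 3) * l₂⁻¹)) * ‖Δ‖ ^ 2 := by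
  have hl0 : 0 < l := hl₂.trans_le hl
  have hρ0 : 0 < ρ := hl0.trans_le hlρ
  have hβ0 : 0 < β := by
    by_contra h
    nlinarith [mul_nonneg hl₂.le (neg_nonneg.2 (not_lt.1 h))]
  have h := modeEnergy_step_le_of_eigenvalue hα hγ hl₂ hl hβ u w e a Δ
  have hD := mul_le_mul_of_nonneg_left (norm_direction_sq_le β γ l u w e a)
    (by positivity : 0 ≤ c * α ^ 2)
  rw [norm_smul_sq]
  have hsq : (β * l) ^ 2 ≤ ρ ^ 2 * β ^ 2 := by
    rw [mul_pow, mul_comm]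
    gcongr
  have hβγ : l₂ * β * γ ≤ l * β * γ := by gcongr
  have hργ : l * γ ^ 2 ≤ ρ * γ ^ 2 := by gcongr
  have h0 : 0 ≤ l₂ * β * γ := by positivity
  have h0' : 0 ≤ ρ * β * γ := by positivity
  have h0'' : 0 ≤ ρ ^ 2 * β ^ 2 := by positivity
  have hcs : c * (β * l) ^ 2 ≤ c * (ρ ^ 2 * β ^ 2) := by gcongr
  have cu : (-(α * (β * l - 3 * γ - 2) / 2) + α ^ 2 * (2 * (β * l) ^ 2 - 3 * (β * l) * γ + γ ^ 2
          + γ ^ 2 * l + 1)) + α ^ 2 * (4 * (c * (β * l) ^ 2))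
      ≤ -(α * ((l₂ * β - 3 * γ - 2) / 2) - α ^ 2 * ((3 + 4 * c) * ρ ^ 2 * β ^ 2 - l₂ * β * γ
          + (ρ + 2) * γ ^ 2 + 1)) := by
    have h1 : α * (l₂ * β) ≤ α * (l * β) := by gcongr
    have h2 : (2 * (β * l) ^ 2 - 3 * (β * l) * γ + γ ^ 2 + γ ^ 2 * l + 1) + 4 * (c * (β * l) ^ 2)
        ≤ (3 + 4 * c) * ρ ^ 2 * β ^ 2 - l₂ * β * γ + (ρ + 2) * γ ^ 2 + 1 := by
      linarith [sq_nonneg γ]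
    have h3 := mul_le_mul_of_nonneg_left h2 (sq_nonneg α)
    linarith
  have ce : (α * (β * l / 2 + γ / 2 + γ * l) + α ^ 2 * (2 * (β * l) ^ 2 - 3 * (β * l) * γ + γ ^ 2
          + γ ^ 2 * l + 1)) + α ^ 2 * (4 * (c * (β * l) ^ 2))
      ≤ α * phiSeven ρ β γ + α ^ 2 * phiEight' ρ l₂ β γ c := by
    unfold phiSeven phiEight'
    have h1 : α * (β * l / 2 + γ / 2 + γ * l) ≤ α * ((ρ + 1) * γ + ρ * β / 2) := by
      refine mul_le_mul_of_nonneg_left ?_ hα.le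
      have : β * l ≤ β * ρ := by gcongr
      have : γ * l ≤ γ * ρ := by gcongr
      linarith
    have h2 : (2 * (β * l) ^ 2 - 3 * (β * l) * γ + γ ^ 2 + γ ^ 2 * l + 1) + 4 * (c * (β * l) ^ 2)
        ≤ (3 + 4 * c) * ρ ^ 2 * β ^ 2 + (ρ - 2 * l₂) * β * γ + (ρ + 2) * γ ^ 2 + 1 := by
      linarith [sq_nonneg γ]
    have h3 := mul_le_mul_of_nonneg_left h2 (sq_nonneg α)
    linarith
  have cw : (-(α * (γ / 2 - 1 / (2 * l₂))) + α ^ 2 * (2 * γ ^ 2 * l + l / 2)) / l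
        + α ^ 2 * (4 * (c * γ ^ 2))
      ≤ -((α * phiThree l₂ γ - α ^ 2 * phiFour' ρ γ c) / l) := by
    unfold phiThree phiFour'
    have h1 : α ^ 2 * ((2 * γ ^ 2 + 1 / 2 + 4 * (c * γ ^ 2)) * l)
        ≤ α ^ 2 * ((2 * γ ^ 2 + 1 / 2 + 4 * (c * γ ^ 2)) * ρ) := by gcongr
    have h2 : α * (1 / (2 * l₂)) ≤ α * (5 / 2 * l₂⁻¹) := by
      refine mul_le_mul_of_nonneg_left ?_ hα.le
      rw [show 1 / (2 * l₂) = 1 / 2 * l₂⁻¹ by field_simp]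
      have : 0 < l₂⁻¹ := by positivity
      linarith
    rw [← neg_div, ← sub_nonneg, show ∀ p q s : ℝ, p / l - (q / l + s) = (p - (q + s * l)) / l by
      intro p q s; field_simp]
    refine div_nonneg ?_ hl0.le
    linarith
  have g1 : 1 / (2 * γ ^ 2 * l ^ 2) ≤ 1 / (2 * γ ^ 2) * (l₂ ^ 2)⁻¹ := by
    rw [one_div, mul_inv, one_div]; gcongr
  have g2 : (β + γ) ^ 2 / (γ ^ 5 * l) ≤ (β + γ) ^ 2 / γ ^ 5 * l₂⁻¹ := by
    rw [div_mul_eq_div_div, div_eq_mul_inv _ l]; gcongr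
  have g3 : 1 / (2 * l ^ 2) ≤ (l₂ ^ 2)⁻¹ / 2 := by
    rw [one_div, mul_inv, mul_comm, div_eq_mul_inv]; gcongr
  have g4 : (β + γ) / (2 * γ ^ 3 * l) ≤ (β + γ) / (2 * γ ^ 3) * l₂⁻¹ := by
    rw [div_mul_eq_div_div, div_eq_mul_inv _ l]; gcongr
  have cΔ : 1 / α * (1 / (2 * γ ^ 2 * l ^ 2) + (β + γ) ^ 2 / (γ ^ 5 * l))
          + (1 / 2 + 1 / (2 * l ^ 2) + 1 / (2 * γ ^ 2 * l ^ 2) + (β + γ) / (2 * γ ^ 3 * l))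
      ≤ 1 / α * (1 / (2 * γ ^ 2) * (l₂ ^ 2)⁻¹ + (β + γ) ^ 2 / γ ^ 5 * l₂⁻¹)
          + (1 / 2 + (l₂ ^ 2)⁻¹ / 2 + 1 / (2 * γ ^ 2) * (l₂ ^ 2)⁻¹
            + (β + γ) / (2 * γ ^ 3) * l₂⁻¹) := by
    gcongr
  have mu := mul_le_mul_of_nonneg_right cu (sq_nonneg ‖u‖)
  have me := mul_le_mul_of_nonneg_right ce (sq_nonneg ‖e‖)
  have mw := mul_le_mul_of_nonneg_right cw (sq_nonneg ‖w‖)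
  have mΔ := mul_le_mul_of_nonneg_right cΔ (sq_nonneg ‖Δ‖)
  linear_combination h + hD + mu + me + mw + mΔ

end Mode

/-! ### Diagonalizing the Laplacian -/

section Spectral

variable {n d : ℕ}

/-- The coefficient of a family of vectors along the vector `b` of weights. -/
noncomputable def modeCoeff (b : EuclideanSpace ℝ (Fin n)) :
    (Fin n → EuclideanSpace ℝ (Fin d)) →ₗ[ℝ] EuclideanSpace ℝ (Fin d) where
  toFun x := ∑ i, b i • x i
  map_add' x y := by simp [Finset.sum_add_distrib]
  map_smul' c x := by simp [Finset.smul_sum, smul_comm c]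

theorem modeCoeff_apply (b : EuclideanSpace ℝ (Fin n)) (x : Fin n → EuclideanSpace ℝ (Fin d)) :
    modeCoeff b x = ∑ i, b i • x i := rfl

/-- Parseval's identity in `ℝⁿ`, applied to each of the `d` coordinates separately. -/
theorem sum_norm_sq_modeCoeff (b : OrthonormalBasis (Fin n) ℝ (EuclideanSpace ℝ (Fin n)))
    (x : Fin n → EuclideanSpace ℝ (Fin d)) :
    ∑ j, ‖modeCoeff (b j) x‖ ^ 2 = ∑ i, ‖x i‖ ^ 2 := by
  simp only [EuclideanSpace.norm_sq_eq]
  rw [Finset.sum_comm, Finset.sum_comm (s := Finset.univ (α := Fin n))]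
  refine Finset.sum_congr rfl fun c _ => ?_
  have h := b.sum_sq_norm_inner_right (WithLp.toLp 2 fun i => x i c)
  rw [EuclideanSpace.norm_sq_eq] at h
  rw [← h]
  refine Finset.sum_congr rfl fun j _ => ?_
  simp [modeCoeff_apply, PiLp.inner_apply, mul_comm]

theorem sum_sub_avg (hn : n ≠ 0) (x : Fin n → EuclideanSpace ℝ (Fin d)) :
    ∑ i, (x i - avg x) = 0 := by
  have : (n : ℝ) ≠ 0 := by exact_mod_cast hn
  simp [avg, Finset.sum_sub_distrib, ← Nat.cast_smul_eq_nsmul ℝ, smul_smul, this]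

theorem sum_norm_sq_sub_avg (hn : n ≠ 0) (x : Fin n → EuclideanSpace ℝ (Fin d)) :
    ∑ i, ‖x i‖ ^ 2 = ∑ i, ‖x i - avg x‖ ^ 2 + n * ‖avg x‖ ^ 2 := by
  have h : ∀ i, ‖x i‖ ^ 2 = ‖x i - avg x‖ ^ 2 + 2 * inner ℝ (x i - avg x) (avg x)
      + ‖avg x‖ ^ 2 := by
    intro i
    rw [← norm_add_sq_real, sub_add_cancel]
  rw [Finset.sum_congr rfl fun i _ => h i, Finset.sum_add_distrib, Finset.sum_add_distrib,
    ← Finset.mul_sum, ← sum_inner, sum_sub_avg hn]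
  simp

theorem laplacian_isHermitian {A : Matrix (Fin n) (Fin n) ℝ} (hA : A.IsSymm) :
    (laplacian A).IsHermitian := by
  rw [Matrix.IsHermitian, Matrix.conjTranspose_eq_transpose_of_trivial]
  simp [laplacian, hA.eq]

theorem sum_laplacian_mul (A : Matrix (Fin n) (Fin n) ℝ) (i : Fin n) (v : Fin n → ℝ) :
    ∑ j, laplacian A i j * v j = ∑ j, A i j * (v i - v j) := by
  simp [laplacian, sub_mul, mul_sub, Finset.sum_sub_distrib, Matrix.diagonal_apply,
    Finset.sum_mul, ite_mul]

theorem laplacian_quadForm {A : Matrix (Fin n) (Fin n) ℝ} (hA : A.IsSymm) (v : Fin n → ℝ) :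
    2 * ∑ i, v i * ∑ j, laplacian A i j * v j = ∑ i, ∑ j, A i j * (v i - v j) ^ 2 := by
  have h1 : ∑ i, v i * ∑ j, laplacian A i j * v j = ∑ i, ∑ j, A i j * (v i * (v i - v j)) := by
    refine Finset.sum_congr rfl fun i _ => ?_
    rw [sum_laplacian_mul, Finset.mul_sum]
    exact Finset.sum_congr rfl fun j _ => by ring
  have h2 : ∑ i, v i * ∑ j, laplacian A i j * v j = ∑ i, ∑ j, A i j * (v j * (v j - v i)) := by
    rw [h1, Finset.sum_comm]
    refine Finset.sum_congr rfl fun i _ => Finset.sum_congr rfl fun j _ => ?_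
    rw [hA.apply]
  rw [two_mul]
  nth_rw 1 [h1]
  rw [h2, ← Finset.sum_add_distrib]
  refine Finset.sum_congr rfl fun i _ => ?_
  rw [← Finset.sum_add_distrib]
  exact Finset.sum_congr rfl fun j _ => by ring

/-- Twice the form is a sum of the nonnegative terms `A i j * (v i - v j) ^ 2`. If it vanishes, `v`
agrees across every edge, hence along every path. -/
theorem IsConnectedWeights.eq_of_quadForm_eq_zero {A : Matrix (Fin n) (Fin n) ℝ}
    (hA : IsConnectedWeights A) {v : Fin n → ℝ}
    (hv : ∑ i, v i * ∑ j, laplacian A i j * v j = 0) (i j : Fin n) : v i = v j := by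
  have h := laplacian_quadForm hA.symm v
  rw [hv, mul_zero] at h
  have hz : ∀ i j, A i j * (v i - v j) ^ 2 = 0 := by
    intro i j
    have h1 := (Finset.sum_eq_zero_iff_of_nonneg (fun i _ => Finset.sum_nonneg fun j _ =>
      mul_nonneg (hA.nonneg i j) (sq_nonneg _))).1 h.symm i (Finset.mem_univ _)
    exact (Finset.sum_eq_zero_iff_of_nonneg (fun j _ =>
      mul_nonneg (hA.nonneg i j) (sq_nonneg _))).1 h1 j (Finset.mem_univ _)
  have hadj : ∀ i j, (supportGraph A).Adj i j → v i = v j := by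
    intro i j hij
    rw [supportGraph, SimpleGraph.fromRel_adj] at hij
    rcases hij.2 with h | h
    · have := hz i j
      rw [mul_eq_zero, or_iff_right h.ne', sq_eq_zero_iff, sub_eq_zero] at this
      exact this
    · have := hz j i
      rw [mul_eq_zero, or_iff_right h.ne', sq_eq_zero_iff, sub_eq_zero] at this
      exact this.symm
  obtain ⟨p⟩ := hA.connected.preconnected i j
  induction p with
  | nil => rfl
  | cons h _ ih => exact (hadj _ _ h).trans ih

/-- A family of coefficients that diagonalizes the matrix `L` and measures the deviation from the
average; the eigenvalues that occur lie between `l₂` and `ρ`. -/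
structure IsModeSystem (d : ℕ) (L : Matrix (Fin n) (Fin n) ℝ) (l₂ ρ : ℝ) (J : Finset (Fin n))
    (b : Fin n → EuclideanSpace ℝ (Fin n)) (l : Fin n → ℝ) : Prop where
  pos : 0 < l₂
  lower : ∀ j ∈ J, l₂ ≤ l j
  upper : ∀ j ∈ J, l j ≤ ρ
  nonempty : J.Nonempty
  col_sum : ∀ k, ∑ i, L i k = 0
  modeCoeff_mul : ∀ (x : Fin n → EuclideanSpace ℝ (Fin d)) (j : Fin n),
    modeCoeff (b j) (fun i => ∑ k, L i k • x k) = l j • modeCoeff (b j) x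
  sum_norm_sq : ∀ x : Fin n → EuclideanSpace ℝ (Fin d),
    ∑ j ∈ J, ‖modeCoeff (b j) x‖ ^ 2 = ∑ i, ‖x i - avg x‖ ^ 2

theorem laplacian_col_sum {A : Matrix (Fin n) (Fin n) ℝ} (hA : A.IsSymm) (k : Fin n) :
    ∑ i, laplacian A i k = 0 := by
  simp [laplacian, Finset.sum_sub_distrib, Matrix.diagonal_apply, hA.apply]

/-- Take for `J` the nonzero eigenvalues. Their eigenvectors have entries summing to zero and do not
see the average; the eigenvectors of the kernel are constant and annihilate the deviation from it.
Parseval for the deviation therefore involves `J` alone. -/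
theorem IsConnectedWeights.exists_isModeSystem (hn : 2 ≤ n) {A : Matrix (Fin n) (Fin n) ℝ}
    (hA : IsConnectedWeights A) :
    ∃ (J : Finset (Fin n)) (b : Fin n → EuclideanSpace ℝ (Fin n)) (l : Fin n → ℝ),
      IsModeSystem d (laplacian A) (rhoTwo (laplacian A)) (rho (laplacian A)) J b l := by
  have hL := laplacian_isHermitian hA.symm
  set L := laplacian A with hLdef
  set b := hL.eigenvectorBasis with hb
  set l := hL.eigenvalues with hl
  have heig : ∀ j i, ∑ k, L i k * b j k = l j * b j i := by
    intro j i
    have := congrFun (hL.mulVec_eigenvectorBasis j) i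
    simpa [Matrix.mulVec, dotProduct] using this
  have hquad : ∀ j, ∑ i, b j i * ∑ k, L i k * b j k = l j := by
    intro j
    have h1 : ‖b j‖ ^ 2 = 1 := by simp
    rw [EuclideanSpace.norm_sq_eq] at h1
    simp only [Real.norm_eq_abs, sq_abs] at h1
    simp only [heig]
    calc _ = l j * ∑ i, b j i ^ 2 := by
          rw [Finset.mul_sum]; exact Finset.sum_congr rfl fun i _ => by ring
      _ = _ := by rw [h1, mul_one]
  have hl0 : ∀ j, 0 ≤ l j := by
    intro j
    have h := laplacian_quadForm hA.symm (b j)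
    rw [← hLdef, hquad] at h
    have : 0 ≤ ∑ i, ∑ k, A i k * (b j i - b j k) ^ 2 := Finset.sum_nonneg fun i _ =>
      Finset.sum_nonneg fun k _ => mul_nonneg (hA.nonneg i k) (sq_nonneg _)
    linarith
  have hconst : ∀ j, l j = 0 → ∀ i k, b j i = b j k := by
    intro j hj
    exact hA.eq_of_quadForm_eq_zero (by rw [← hLdef, hquad, hj])
  have hfin : (spectrum ℝ L).Finite := Matrix.finite_real_spectrum
  have hmem : ∀ j, l j ∈ spectrum ℝ L := hL.eigenvalues_mem_spectrum_real
  have hrho : ∀ j, l j ≤ rho L := by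
    intro j
    -- Finiteness matters because `toReal` sends `⊤` to `0`.
    have hlt : spectralRadius ℝ L < ⊤ := by
      obtain ⟨M, hM⟩ := (hfin.image fun k => ‖k‖₊).bddAbove
      refine lt_of_le_of_lt (iSup₂_le fun k hk => ?_) (ENNReal.coe_lt_top (r := M))
      exact_mod_cast hM ⟨k, hk, rfl⟩
    have h1 : (‖l j‖₊ : ℝ≥0∞) ≤ spectralRadius ℝ L :=
      le_iSup₂ (f := fun k (_ : k ∈ spectrum ℝ L) => (‖k‖₊ : ℝ≥0∞)) (l j) (hmem j)
    have h2 := ENNReal.toReal_mono hlt.ne h1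
    simp only [ENNReal.coe_toReal, coe_nnnorm, Real.norm_eq_abs] at h2
    exact (le_abs_self _).trans h2
  have hone : ∀ j, l j ≠ 0 → ∑ i, b j i = 0 := by
    intro j hj
    have h1 : ∑ i, ∑ k, L i k * b j k = l j * ∑ i, b j i := by
      rw [Finset.mul_sum]; exact Finset.sum_congr rfl fun i _ => heig j i
    have h2 : ∑ i, ∑ k, L i k * b j k = 0 := by
      have h3 : ∀ i, ∑ k, L i k * b j k = ∑ k, A i k * (b j i - b j k) :=
        fun i => sum_laplacian_mul A i (b j)
      simp only [h3, mul_sub, Finset.sum_sub_distrib]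
      rw [sub_eq_zero, Finset.sum_comm]
      refine Finset.sum_congr rfl fun i _ => Finset.sum_congr rfl fun k _ => ?_
      rw [hA.symm.apply]
    rw [h2] at h1
    exact (mul_eq_zero.1 h1.symm).resolve_left hj
  -- Otherwise two orthonormal eigenvectors would both be constant, and their orthogonality would
  -- make one of them zero.
  have hex : ∃ j, l j ≠ 0 := by
    by_contra hcon
    push Not at hcon
    have hij : (⟨0, by omega⟩ : Fin n) ≠ ⟨1, by omega⟩ := by simp
    have horth : inner ℝ (b ⟨0, by omega⟩) (b ⟨1, by omega⟩) = 0 := b.orthonormal.2 hij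
    have hu0 := b.orthonormal.1 ⟨0, by omega⟩
    have hu1 := b.orthonormal.1 ⟨1, by omega⟩
    set p := b ⟨0, by omega⟩
    set q := b ⟨1, by omega⟩
    obtain ⟨cp, hp⟩ : ∃ c, ∀ i, p i = c := ⟨p ⟨0, by omega⟩, fun i => hconst _ (hcon _) _ _⟩
    obtain ⟨cq, hq⟩ : ∃ c, ∀ i, q i = c := ⟨q ⟨0, by omega⟩, fun i => hconst _ (hcon _) _ _⟩
    have hn0 : (n : ℝ) ≠ 0 := by positivity
    rw [PiLp.inner_apply] at horth
    simp only [hp, hq] at horth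
    simp [hn0] at horth
    rcases horth with h | h
    · have : q = 0 := by ext i; rw [hq, h]; rfl
      rw [this] at hu1; simp at hu1
    · have : p = 0 := by ext i; rw [hp, h]; rfl
      rw [this] at hu0; simp at hu0
  have hpos : 0 < rhoTwo L := by
    obtain ⟨j, hj⟩ := hex
    have hne : {μ : ℝ | 0 < μ ∧ μ ∈ spectrum ℝ L}.Nonempty :=
      ⟨l j, lt_of_le_of_ne (hl0 j) hj.symm, hmem j⟩
    exact (hne.csInf_mem (hfin.subset fun _ h => h.2)).1
  refine ⟨Finset.univ.filter (fun j => l j ≠ 0), fun j => b j, l, hpos, ?_, fun j _ => hrho j, ?_,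
    laplacian_col_sum hA.symm, ?_, ?_⟩
  · intro j hj
    simp only [Finset.mem_filter, Finset.mem_univ, true_and] at hj
    exact csInf_le ⟨0, fun _ h => h.1.le⟩ ⟨lt_of_le_of_ne (hl0 j) hj.symm, hmem j⟩
  · obtain ⟨j, hj⟩ := hex
    exact ⟨j, by simpa using hj⟩
  · intro x j
    simp only [modeCoeff_apply, Finset.smul_sum, smul_smul]
    rw [Finset.sum_comm]
    refine Finset.sum_congr rfl fun k _ => ?_
    rw [← Finset.sum_smul, ← heig]
    congr 1
    refine Finset.sum_congr rfl fun i _ => ?_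
    rw [mul_comm, ← hL.apply k i]; simp
  · intro x
    rw [← sum_norm_sq_modeCoeff b (fun i => x i - avg x), Finset.sum_filter]
    refine Finset.sum_congr rfl fun j _ => ?_
    split_ifs with h
    · congr 2
      simp only [modeCoeff_apply, smul_sub, Finset.sum_sub_distrib]
      rw [← Finset.sum_smul, hone j h, zero_smul, sub_zero]
    · rw [not_not] at h
      have hi : ∀ i, b j i = b j ⟨0, by omega⟩ := fun i => hconst j h _ _
      have : modeCoeff (b j) (fun i => x i - avg x) = 0 := by
        rw [modeCoeff_apply, Finset.sum_congr rfl fun i _ => by rw [hi i], ← Finset.smul_sum,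
          sum_sub_avg (by omega), smul_zero]
      rw [this]; simp

end Spectral

/-! ### Smooth costs and the descent lemma -/

section Smooth

variable {n d : ℕ}

/-- Along the segment from `x` to `y`, subtracting the linear and quadratic terms of the majorant
from `g` leaves a function whose derivative is nonpositive by the Lipschitz bound. -/
theorem IsSmoothWith.le_quadratic {ℓ : ℝ} {g : EuclideanSpace ℝ (Fin d) → ℝ}
    (hg : IsSmoothWith ℓ g) (x y : EuclideanSpace ℝ (Fin d)) :
    g y ≤ g x + inner ℝ (gradient g x) (y - x) + ℓ / 2 * ‖y - x‖ ^ 2 := by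
  set h : ℝ → ℝ := fun t => g (x + t • (y - x)) - t * inner ℝ (gradient g x) (y - x)
    - t ^ 2 * (ℓ / 2 * ‖y - x‖ ^ 2) with hh
  have hd : ∀ t, HasDerivAt h (inner ℝ (gradient g (x + t • (y - x))) (y - x)
      - 1 * inner ℝ (gradient g x) (y - x) - 2 * t * (ℓ / 2 * ‖y - x‖ ^ 2)) t := by
    intro t
    have hline : HasDerivAt (fun t : ℝ => x + t • (y - x)) ((1 : ℝ) • (y - x)) t :=
      ((hasDerivAt_id t).smul_const (y - x)).const_add x
    have h1 := (hg.1 (x + t • (y - x))).hasFDerivAt.comp_hasDerivAt t hline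
    rw [one_smul, ← inner_gradient_left] at h1
    have h2 := (hasDerivAt_pow 2 t).mul_const (ℓ / 2 * ‖y - x‖ ^ 2)
    simp only [Nat.cast_ofNat, Nat.add_one_sub_one, pow_one] at h2
    exact (h1.sub ((hasDerivAt_id t).mul_const _)).sub h2
  have hanti : AntitoneOn h (Set.Icc 0 1) := by
    refine antitoneOn_of_deriv_nonpos (convex_Icc 0 1)
      (fun t _ => (hd t).continuousAt.continuousWithinAt)
      (fun t _ => (hd t).differentiableAt.differentiableWithinAt) fun t ht => ?_
    rw [interior_Icc] at ht
    rw [(hd t).deriv]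
    have h1 : inner ℝ (gradient g (x + t • (y - x)) - gradient g x) (y - x)
        ≤ ℓ * (t * ‖y - x‖) * ‖y - x‖ := by
      refine (real_inner_le_norm _ _).trans ?_
      refine mul_le_mul_of_nonneg_right ?_ (norm_nonneg _)
      refine (hg.2 _ _).trans_eq ?_
      rw [add_sub_cancel_left, norm_smul, Real.norm_eq_abs, abs_of_pos ht.1]
    rw [inner_sub_left] at h1
    linarith
  have := hanti (by simp) (by simp) (zero_le_one (α := ℝ))
  simp only [hh, one_smul, zero_smul, add_zero, add_sub_cancel] at this
  linarith

theorem gradient_globalCost {f : Fin n → EuclideanSpace ℝ (Fin d) → ℝ}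
    (hf : ∀ i, Differentiable ℝ (f i)) (x : EuclideanSpace ℝ (Fin d)) :
    gradient (globalCost f) x = avg fun i => gradient (f i) x := by
  refine HasGradientAt.gradient ?_
  rw [hasGradientAt_iff_hasFDerivAt]
  have h := (HasFDerivAt.fun_sum (u := Finset.univ)
    fun i _ => (hf i x).hasGradientAt.hasFDerivAt).const_mul (n : ℝ)⁻¹
  have e : InnerProductSpace.toDual ℝ _ (avg fun i => gradient (f i) x)
      = (n : ℝ)⁻¹ • ∑ i, InnerProductSpace.toDual ℝ _ (gradient (f i) x) := by
    simp [avg]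
  rw [e]
  exact h

theorem avg_sub (x y : Fin n → EuclideanSpace ℝ (Fin d)) : avg (x - y) = avg x - avg y := by
  simp [avg, Finset.sum_sub_distrib, smul_sub]

theorem isSmoothWith_globalCost (hn : n ≠ 0) {ℓ : ℝ}
    {f : Fin n → EuclideanSpace ℝ (Fin d) → ℝ} (hf : ∀ i, IsSmoothWith ℓ (f i)) :
    IsSmoothWith ℓ (globalCost f) := by
  have hn' : (n : ℝ) ≠ 0 := by exact_mod_cast hn
  refine ⟨?_, fun x y => ?_⟩
  · have : Differentiable ℝ fun x => ∑ i, f i x := Differentiable.fun_sum fun i _ => (hf i).1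
    exact this.const_mul _
  · rw [gradient_globalCost (fun i => (hf i).1), gradient_globalCost (fun i => (hf i).1), ← avg_sub,
      avg, norm_smul, norm_inv, RCLike.norm_natCast]
    refine (mul_le_mul_of_nonneg_left ((norm_sum_le _ _).trans
      (Finset.sum_le_sum fun i _ => (hf i).2 x y)) (by positivity)).trans_eq ?_
    simp only [Finset.sum_const, Finset.card_univ, Fintype.card_fin, nsmul_eq_mul]
    field_simp

end Smooth

/-! ### Descent of the Lyapunov function along one realization -/

section Descent

variable {n d : ℕ}

/-- The Lyapunov function of the primal-dual dynamics, without the compression error. -/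
noncomputable def lyapunov (f : Fin n → EuclideanSpace ℝ (Fin d) → ℝ) (β γ : ℝ)
    (J : Finset (Fin n)) (b : Fin n → EuclideanSpace ℝ (Fin n)) (l : Fin n → ℝ) (m : ℝ)
    (x v : Fin n → EuclideanSpace ℝ (Fin d)) : ℝ :=
  ∑ j ∈ J, modeEnergy β γ (l j) (modeCoeff (b j) x)
    (modeCoeff (b j) (v + γ⁻¹ • fun i => gradient (f i) (avg x)))
  + n * (globalCost f (avg x) - m)

variable {L : Matrix (Fin n) (Fin n) ℝ} {l₂ ρ : ℝ} {J : Finset (Fin n)}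
  {b : Fin n → EuclideanSpace ℝ (Fin n)} {l : Fin n → ℝ}
  {f : Fin n → EuclideanSpace ℝ (Fin d) → ℝ} {α β γ ℓ m c : ℝ}

theorem le_lyapunov (hM : IsModeSystem d L l₂ ρ J b l) (hγ : 0 < γ) (hβ : 4 * γ ≤ l₂ * β)
    (x v : Fin n → EuclideanSpace ℝ (Fin d)) :
    n * (globalCost f (avg x) - m) ≤ lyapunov f β γ J b l m x v := by
  have hβ0 : 0 < β := by
    by_contra h
    nlinarith [mul_nonneg hM.pos.le (neg_nonneg.2 (not_lt.1 h))]
  refine le_add_of_nonneg_left (Finset.sum_nonneg fun j hj => ?_)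
  have h1 := mul_le_mul_of_nonneg_right (hM.lower j hj) hβ0.le
  exact modeEnergy_nonneg hγ (hM.pos.trans_le (hM.lower j hj)) (by linarith) _ _

theorem IsModeSystem.sum_norm_sq_le (hM : IsModeSystem d L l₂ ρ J b l) (hn : n ≠ 0)
    (x : Fin n → EuclideanSpace ℝ (Fin d)) :
    ∑ j ∈ J, ‖modeCoeff (b j) x‖ ^ 2 ≤ ∑ i, ‖x i‖ ^ 2 := by
  rw [hM.sum_norm_sq, sum_norm_sq_sub_avg hn x]
  have : 0 ≤ (n : ℝ) * ‖avg x‖ ^ 2 := by positivity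
  linarith

theorem IsModeSystem.sum_mul_eq_zero (hM : IsModeSystem d L l₂ ρ J b l)
    (x : Fin n → EuclideanSpace ℝ (Fin d)) : ∑ i, ∑ k, L i k • x k = 0 := by
  rw [Finset.sum_comm]
  simp [← Finset.sum_smul, hM.col_sum]

-- Here `z` plays the role of `x̂_k`. The mode inequalities are summed and added to `n` times the
-- descent lemma at the average; the negative multiple of `‖avg g‖ ^ 2` from the latter absorbs
-- everything caused by the motion of the average.
set_option maxHeartbeats 1000000 in
theorem lyapunov_step_le (hM : IsModeSystem d L l₂ ρ J b l) (hn : n ≠ 0)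
    (hf : ∀ i, IsSmoothWith ℓ (f i)) (hα : 0 < α) (hγ : 0 < γ)
    (hβ : 4 * γ ≤ l₂ * β) (hc : 0 ≤ c)
    (h34 : α * phiFour' ρ γ c ≤ phiThree l₂ γ)
    (h56 : α * phiSix l₂ ℓ β γ + α * c ≤ phiFive l₂ ℓ β γ + 3 / 8)
    (h78 : 0 ≤ phiSeven ρ β γ + α * phiEight' ρ l₂ β γ c)
    {x v z x' v' : Fin n → EuclideanSpace ℝ (Fin d)} (hv : ∑ i, v i = 0)
    (hx' : x' = x - α • (β • (fun i => ∑ k, L i k • z k) + γ • v + fun i => gradient (f i) (x i)))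
    (hv' : v' = v + (α * γ) • fun i => ∑ k, L i k • z k) :
    lyapunov f β γ J b l m x' v' + c * ∑ i, ‖x' i - x i‖ ^ 2
      ≤ lyapunov f β γ J b l m x v
        - (α * phiOne l₂ ℓ β γ - α ^ 2 * phiTwo' ρ l₂ ℓ β γ c) * ∑ i, ‖x i - avg x‖ ^ 2
        - α / 2 * (n * ‖gradient (globalCost f) (avg x)‖ ^ 2)
        + (α * phiSeven ρ β γ + α ^ 2 * phiEight' ρ l₂ β γ c) * ∑ i, ‖x i - z i‖ ^ 2 := by
  have hnpos : (0 : ℝ) < n := by exact_mod_cast Nat.pos_of_ne_zero hn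
  set y : Fin n → EuclideanSpace ℝ (Fin d) := fun i => ∑ k, L i k • z k with hy
  set g : Fin n → EuclideanSpace ℝ (Fin d) := fun i => gradient (f i) (x i) with hg
  set g₀ : Fin n → EuclideanSpace ℝ (Fin d) := fun i => gradient (f i) (avg x) with hg₀
  set g₁ : Fin n → EuclideanSpace ℝ (Fin d) := fun i => gradient (f i) (avg x') with hg₁
  -- The average moves by `avg g` only, since both `L z` and `v` sum to zero.
  have havg : avg x' = avg x - α • avg g := by
    have hy0 : ∑ i, y i = 0 := hM.sum_mul_eq_zero z
    rw [hx', avg_sub]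
    congr 1
    simp only [avg, Pi.smul_apply, Pi.add_apply, ← Finset.smul_sum, Finset.sum_add_distrib, hy0, hv,
      smul_zero, zero_add]
    rw [smul_comm]
  have hmode : ∀ j ∈ J, modeEnergy β γ (l j) (modeCoeff (b j) x') (modeCoeff (b j) (v' + γ⁻¹ • g₁))
      + c * ‖modeCoeff (b j) (x' - x)‖ ^ 2
      ≤ modeEnergy β γ (l j) (modeCoeff (b j) x) (modeCoeff (b j) (v + γ⁻¹ • g₀))
        - (α * ((l₂ * β - 3 * γ - 2) / 2) - α ^ 2 * ((3 + 4 * c) * ρ ^ 2 * β ^ 2 - l₂ * β * γ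
          + (ρ + 2) * γ ^ 2 + 1)) * ‖modeCoeff (b j) x‖ ^ 2
        + (α * phiSeven ρ β γ + α ^ 2 * phiEight' ρ l₂ β γ c) * ‖modeCoeff (b j) (x - z)‖ ^ 2
        + (α + α ^ 2 * (5 / 2 + 4 * c)) * ‖modeCoeff (b j) (g - g₀)‖ ^ 2
        + (1 / α * (1 / (2 * γ ^ 2) * (l₂ ^ 2)⁻¹ + (β + γ) ^ 2 / γ ^ 5 * l₂⁻¹)
          + (1 / 2 + (l₂ ^ 2)⁻¹ / 2 + 1 / (2 * γ ^ 2) * (l₂ ^ 2)⁻¹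
            + (β + γ) / (2 * γ ^ 3) * l₂⁻¹)) * ‖modeCoeff (b j) (g₁ - g₀)‖ ^ 2 := by
    intro j hj
    have h := modeEnergy_step_le hα hγ hM.pos (hM.lower j hj) (hM.upper j hj) hβ hc
      (modeCoeff (b j) x) (modeCoeff (b j) (v + γ⁻¹ • g₀)) (modeCoeff (b j) (x - z))
      (modeCoeff (b j) (g - g₀)) (modeCoeff (b j) (g₁ - g₀))
    have hyj : modeCoeff (b j) y = l j • modeCoeff (b j) z := hM.modeCoeff_mul z j
    have e1 : (β * l j) • (modeCoeff (b j) x - modeCoeff (b j) (x - z))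
        + γ • modeCoeff (b j) (v + γ⁻¹ • g₀) + modeCoeff (b j) (g - g₀)
        = modeCoeff (b j) (β • y + γ • v + g) := by
      simp only [map_add, map_sub, map_smul, hyj, smul_add, smul_smul, mul_inv_cancel₀ hγ.ne',
        one_smul, sub_sub_cancel]
      abel
    have e2 : modeCoeff (b j) x - α • modeCoeff (b j) (β • y + γ • v + g)
        = modeCoeff (b j) x' := by
      rw [hx', map_sub, map_smul]
    have e3 : modeCoeff (b j) (v + γ⁻¹ • g₀)
        + (α * γ * l j) • (modeCoeff (b j) x - modeCoeff (b j) (x - z))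
        + γ⁻¹ • modeCoeff (b j) (g₁ - g₀) = modeCoeff (b j) (v' + γ⁻¹ • g₁) := by
      rw [hv']
      simp only [map_add, map_sub, map_smul, hyj, smul_sub, smul_smul, sub_sub_cancel]
      abel
    have e4 : ‖α • modeCoeff (b j) (β • y + γ • v + g)‖ ^ 2 = ‖modeCoeff (b j) (x' - x)‖ ^ 2 := by
      rw [hx', sub_sub_cancel_left, map_neg, norm_neg, map_smul]
    rw [e1, e2, e3, e4] at h
    have hw : 0 ≤ (α * phiThree l₂ γ - α ^ 2 * phiFour' ρ γ c) / l j
        * ‖modeCoeff (b j) (v + γ⁻¹ • g₀)‖ ^ 2 := by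
      refine mul_nonneg (div_nonneg ?_ (hM.pos.trans_le (hM.lower j hj)).le) (sq_nonneg _)
      have := mul_le_mul_of_nonneg_left h34 hα.le
      linarith
    linarith
  have hsum := Finset.sum_le_sum hmode
  simp only [Finset.sum_add_distrib, Finset.sum_sub_distrib, ← Finset.mul_sum] at hsum
  rw [hM.sum_norm_sq (x' - x), hM.sum_norm_sq x, hM.sum_norm_sq (g - g₀)] at hsum
  have hE := mul_le_mul_of_nonneg_left (hM.sum_norm_sq_le hn (x - z))
    (by nlinarith : 0 ≤ α * phiSeven ρ β γ + α ^ 2 * phiEight' ρ l₂ β γ c)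
  simp only [Pi.sub_apply] at hE
  have hxx := sum_norm_sq_sub_avg hn (x' - x)
  have havgx : ‖avg (x' - x)‖ ^ 2 = α ^ 2 * ‖avg g‖ ^ 2 := by
    rw [avg_sub, havg, sub_sub_cancel_left, norm_neg, norm_smul_sq]
  rw [havgx] at hxx
  have hgg := sum_norm_sq_sub_avg hn (g - g₀)
  have hglip : ∑ i, ‖(g - g₀) i‖ ^ 2 ≤ ℓ ^ 2 * ∑ i, ‖x i - avg x‖ ^ 2 := by
    rw [Finset.mul_sum]
    refine Finset.sum_le_sum fun i _ => ?_
    rw [← mul_pow]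
    exact pow_le_pow_left₀ (norm_nonneg _) ((hf i).2 _ _) 2
  -- The dual target changes only through the average, which moves by `α * ‖avg g‖`; this turns the
  -- factor `1 / α` into `α`.
  have hΔ : ∑ j ∈ J, ‖modeCoeff (b j) (g₁ - g₀)‖ ^ 2 ≤ α ^ 2 * ℓ ^ 2 * (n * ‖avg g‖ ^ 2) := by
    refine (hM.sum_norm_sq_le hn _).trans ?_
    have : ∀ i ∈ Finset.univ, ‖(g₁ - g₀) i‖ ^ 2 ≤ (ℓ * (α * ‖avg g‖)) ^ 2 := by
      intro i _
      refine pow_le_pow_left₀ (norm_nonneg _) (((hf i).2 _ _).trans_eq ?_) 2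
      rw [havg, sub_sub_cancel_left, norm_neg, norm_smul, Real.norm_eq_abs, abs_of_pos hα]
    refine (Finset.sum_le_sum this).trans_eq ?_
    simp only [Finset.sum_const, Finset.card_univ, Fintype.card_fin, nsmul_eq_mul]
    ring
  have hcost := (isSmoothWith_globalCost hn hf).le_quadratic (avg x) (avg x')
  have hgrad : gradient (globalCost f) (avg x) = avg g₀ := gradient_globalCost (fun i => (hf i).1) _
  rw [hgrad] at hcost ⊢
  rw [havg, sub_sub_cancel_left, norm_neg, norm_smul_sq, inner_neg_right, inner_smul_right] at hcost
  -- Polarization gives the dissipated `‖∇f(x̄)‖²` and a second negative term, in `‖avg g‖ ^ 2`, at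
  -- the price of the gradient mismatch `avg (g - g₀)`.
  have hpol : inner ℝ (avg g₀) (avg g)
      = 1 / 2 * ‖avg g₀‖ ^ 2 + 1 / 2 * ‖avg g‖ ^ 2 - 1 / 2 * ‖avg (g - g₀)‖ ^ 2 := by
    rw [avg_sub, norm_sub_sq_real, real_inner_comm]
    ring
  rw [hpol, ← havg] at hcost
  have hcost' := mul_le_mul_of_nonneg_left hcost hnpos.le
  have hβ0 : 0 < β := by
    by_contra h
    nlinarith [mul_nonneg hM.pos.le (neg_nonneg.2 (not_lt.1 h))]
  have hl₂ := hM.pos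
  have hΔ' := mul_le_mul_of_nonneg_left hΔ
    (by positivity : 0 ≤ 1 / α * (1 / (2 * γ ^ 2) * (l₂ ^ 2)⁻¹ + (β + γ) ^ 2 / γ ^ 5 * l₂⁻¹)
          + (1 / 2 + (l₂ ^ 2)⁻¹ / 2 + 1 / (2 * γ ^ 2) * (l₂ ^ 2)⁻¹
            + (β + γ) / (2 * γ ^ 3) * l₂⁻¹))
  have hΔeq : (1 / α * (1 / (2 * γ ^ 2) * (l₂ ^ 2)⁻¹ + (β + γ) ^ 2 / γ ^ 5 * l₂⁻¹)
          + (1 / 2 + (l₂ ^ 2)⁻¹ / 2 + 1 / (2 * γ ^ 2) * (l₂ ^ 2)⁻¹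
            + (β + γ) / (2 * γ ^ 3) * l₂⁻¹)) * (α ^ 2 * ℓ ^ 2 * (n * ‖avg g‖ ^ 2))
      = (α * (1 / 8 - phiFive l₂ ℓ β γ) + α ^ 2 * (phiSix l₂ ℓ β γ - ℓ / 2))
        * (n * ‖avg g‖ ^ 2) := by
    have : 1 / α * α ^ 2 = α := by field_simp
    unfold phiFive phiSix
    linear_combination (1 / (2 * γ ^ 2) * (l₂ ^ 2)⁻¹ + (β + γ) ^ 2 / γ ^ 5 * l₂⁻¹) * ℓ ^ 2
      * (n * ‖avg g‖ ^ 2) * this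
  rw [hΔeq] at hΔ'
  have hN : 0 ≤ n * ‖avg g‖ ^ 2 := by positivity
  -- Of the available `α / 2` in front of `n * ‖avg g‖ ^ 2`, the definition of `phiFive` accounts
  -- for `1 / 8`; the other `3 / 8` is the constant in `h56`.
  have h56' := mul_le_mul_of_nonneg_right (mul_le_mul_of_nonneg_left h56 hα.le) hN
  have hglip' := mul_le_mul_of_nonneg_left hglip
    (by positivity : 0 ≤ α + α ^ 2 * (5 / 2 + 4 * c))
  rw [hgg] at hglip'
  -- The modes use only the deviation part of `g - g₀`, while the Lipschitz bound covers all of it.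
  -- The spare average part pays for the mismatch from `hpol`, and this is what is left over.
  have hQ : 0 ≤ (α / 2 + α ^ 2 * (5 / 2 + 4 * c)) * (n * ‖avg (g - g₀)‖ ^ 2) := by positivity
  have hxx' : ∑ i, ‖x' i - x i‖ ^ 2 = ∑ i, ‖(x' - x) i - avg (x' - x)‖ ^ 2
      + n * (α ^ 2 * ‖avg g‖ ^ 2) := hxx
  unfold lyapunov
  rw [hxx']
  unfold phiOne phiTwo'
  linear_combination hsum + hE + hcost' + hΔ' + h56' + hglip' + hQ

end Descent

/-! ### Square integrability -/

section Integrability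

variable {n d : ℕ} {Ω : Type*} [MeasurableSpace Ω] {μ : Measure Ω}

theorem memLp_avg {Y : Ω → Fin n → EuclideanSpace ℝ (Fin d)}
    (hY : ∀ i, MemLp (fun w => Y w i) 2 μ) : MemLp (fun w => avg (Y w)) 2 μ :=
  (memLp_finsetSum Finset.univ fun i _ => hY i).const_smul (n : ℝ)⁻¹

theorem memLp_modeCoeff (b : EuclideanSpace ℝ (Fin n)) {Y : Ω → Fin n → EuclideanSpace ℝ (Fin d)}
    (hY : ∀ i, MemLp (fun w => Y w i) 2 μ) : MemLp (fun w => modeCoeff b (Y w)) 2 μ :=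
  memLp_finsetSum Finset.univ fun i _ => (hY i).const_smul (b i)

theorem integrable_norm_sq {E : Type*} [NormedAddCommGroup E] {Y : Ω → E} (hY : MemLp Y 2 μ) :
    Integrable (fun w => ‖Y w‖ ^ 2) μ :=
  (memLp_two_iff_integrable_sq_norm hY.1).1 hY

theorem integrable_inner_of_memLp {E : Type*} [NormedAddCommGroup E] [InnerProductSpace ℝ E]
    {Y Z : Ω → E} (hY : MemLp Y 2 μ) (hZ : MemLp Z 2 μ) :
    Integrable (fun w => inner ℝ (Y w) (Z w)) μ := by
  have h := (((integrable_norm_sq (hY.add hZ)).sub (integrable_norm_sq hY)).sub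
    (integrable_norm_sq hZ)).const_mul (1 / 2)
  refine h.congr (Eventually.of_forall fun w => ?_)
  simp only [Pi.add_apply, Pi.sub_apply]
  rw [norm_add_sq_real]
  ring

theorem integrable_modeEnergy {E : Type*} [NormedAddCommGroup E] [InnerProductSpace ℝ E]
    (β γ l : ℝ) {Y Z : Ω → E} (hY : MemLp Y 2 μ) (hZ : MemLp Z 2 μ) :
    Integrable (fun w => modeEnergy β γ l (Y w) (Z w)) μ :=
  (((integrable_norm_sq hY).const_mul _).add ((integrable_norm_sq hZ).const_mul _)).add
    ((integrable_inner_of_memLp hY hZ).const_mul _)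

theorem IsSmoothWith.continuous_gradient {ℓ : ℝ} {g : EuclideanSpace ℝ (Fin d) → ℝ}
    (hg : IsSmoothWith ℓ g) : Continuous (gradient g) :=
  (LipschitzWith.of_dist_le_mul (K := ℓ.toNNReal) fun x y => by
    rw [dist_eq_norm, dist_eq_norm]
    exact (hg.2 x y).trans
      (mul_le_mul_of_nonneg_right (Real.le_coe_toNNReal ℓ) (norm_nonneg _))).continuous

theorem IsSmoothWith.memLp_gradient [IsFiniteMeasure μ] {ℓ : ℝ}
    {g : EuclideanSpace ℝ (Fin d) → ℝ} (hg : IsSmoothWith ℓ g)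
    {Y : Ω → EuclideanSpace ℝ (Fin d)} (hY : MemLp Y 2 μ) :
    MemLp (fun w => gradient g (Y w)) 2 μ := by
  have hconst : MemLp (fun _ : Ω => ‖gradient g 0‖) 2 μ := memLp_const _
  have hlin : MemLp (fun w => ℓ * ‖Y w‖) 2 μ := hY.norm.const_mul ℓ
  have h : MemLp (fun w => ‖gradient g 0‖ + ℓ * ‖Y w‖) 2 μ := hconst.add hlin
  refine h.of_le (hg.continuous_gradient.comp_aestronglyMeasurable hY.1)
    (Eventually.of_forall fun w => ?_)
  refine le_trans ?_ (le_abs_self _)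
  have h1 := hg.2 (Y w) 0
  rw [sub_zero] at h1
  linarith [norm_le_norm_add_norm_sub (gradient g 0) (gradient g (Y w)),
    norm_sub_rev (gradient g (Y w)) (gradient g 0)]

/-- The integrand lies between zero and the quadratic majorant at the origin. -/
theorem IsSmoothWith.integrable_sub_const [IsFiniteMeasure μ] {ℓ m : ℝ}
    {g : EuclideanSpace ℝ (Fin d) → ℝ} (hg : IsSmoothWith ℓ g) (hm : ∀ z, m ≤ g z)
    {Y : Ω → EuclideanSpace ℝ (Fin d)} (hY : MemLp Y 2 μ) :
    Integrable (fun w => g (Y w) - m) μ := by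
  have h : Integrable (fun w => (g 0 - m) + inner ℝ (gradient g 0) (Y w)
      + ℓ / 2 * ‖Y w‖ ^ 2) μ :=
    ((integrable_const _).add (integrable_inner_of_memLp (memLp_const _) hY)).add
      ((integrable_norm_sq hY).const_mul _)
  refine h.mono' ((hg.1.continuous.comp_aestronglyMeasurable hY.1).sub
    aestronglyMeasurable_const) (Eventually.of_forall fun w => ?_)
  rw [Real.norm_eq_abs, abs_of_nonneg (sub_nonneg.2 (hm _))]
  have := hg.le_quadratic 0 (Y w)
  rw [sub_zero] at this
  linarith

theorem integrable_lyapunov [IsFiniteMeasure μ] (hn : n ≠ 0)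
    {f : Fin n → EuclideanSpace ℝ (Fin d) → ℝ} {ℓ m : ℝ} (hf : ∀ i, IsSmoothWith ℓ (f i))
    (hm : ∀ z, m ≤ globalCost f z) (β γ : ℝ) (J : Finset (Fin n))
    (b : Fin n → EuclideanSpace ℝ (Fin n)) (l : Fin n → ℝ)
    {X V : Ω → Fin n → EuclideanSpace ℝ (Fin d)} (hX : ∀ i, MemLp (fun w => X w i) 2 μ)
    (hV : ∀ i, MemLp (fun w => V w i) 2 μ) :
    Integrable (fun w => lyapunov f β γ J b l m (X w) (V w)) μ := by
  refine (integrable_finsetSum _ fun j _ => integrable_modeEnergy _ _ _ (memLp_modeCoeff _ hX)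
    (memLp_modeCoeff (b j) fun i => ?_)).add
    (((isSmoothWith_globalCost hn hf).integrable_sub_const hm (memLp_avg hX)).const_mul _)
  exact (hV i).add (((hf i).memLp_gradient (memLp_avg hX)).const_smul γ⁻¹)

end Integrability

/-! ### The compressor on random inputs -/

section Compression

variable {d : ℕ} {Ω Ξ : Type*} [MeasurableSpace Ω] [MeasurableSpace Ξ]
  {μ : Measure Ω} [IsProbabilityMeasure μ] {ν : Measure Ξ} [IsProbabilityMeasure ν]
  {𝒞 : Ξ → EuclideanSpace ℝ (Fin d) → EuclideanSpace ℝ (Fin d)} {r δ C : ℝ}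

/-- The compressor bound along an input that is independent of the internal randomness. -/
theorem IsGloballyBounded.integral_le_of_indepFun (h𝒞 : IsGloballyBounded ν 𝒞 r δ C)
    {Z : Ω → EuclideanSpace ℝ (Fin d)} {ζ : Ω → Ξ} (hZm : Measurable Z) (hZ : MemLp Z 2 μ)
    (hζ : Measurable ζ) (hlaw : μ.map ζ = ν) (hind : IndepFun Z ζ μ) :
    MemLp (fun w => r⁻¹ • 𝒞 (ζ w) (Z w) - Z w) 2 μ ∧
    ∫ w, ‖r⁻¹ • 𝒞 (ζ w) (Z w) - Z w‖ ^ 2 ∂μ ≤ (1 - δ) * ∫ w, ‖Z w‖ ^ 2 ∂μ + C := by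
  -- By independence the joint law is a product, so the bound at a fixed input can be integrated
  -- over the input by Fubini.
  have hprod : μ.map (fun w => (Z w, ζ w)) = (μ.map Z).prod ν := by
    rw [(indepFun_iff_map_prod_eq_prod_map_map hZm.aemeasurable hζ.aemeasurable).1 hind, hlaw]
  have : IsProbabilityMeasure (μ.map Z) := Measure.isProbabilityMeasure_map hZm.aemeasurable
  set G : EuclideanSpace ℝ (Fin d) × Ξ → EuclideanSpace ℝ (Fin d) :=
    fun p => r⁻¹ • 𝒞 p.2 p.1 - p.1 with hG
  have hGm : Measurable G :=
    ((h𝒞.measurable.comp (measurable_snd.prodMk measurable_fst)).const_smul r⁻¹).sub measurable_fst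
  have hFm : Measurable fun p => ‖G p‖ ^ 2 := hGm.norm.pow_const 2
  have hZsq : Integrable (fun z => ‖z‖ ^ 2) (μ.map Z) :=
    (integrable_map_measure (by fun_prop) hZm.aemeasurable).2 (integrable_norm_sq hZ)
  have hdom : Integrable (fun z => (1 - δ) * ‖z‖ ^ 2 + C) (μ.map Z) :=
    (hZsq.const_mul _).add (integrable_const _)
  have hint : Integrable (fun p => ‖G p‖ ^ 2) ((μ.map Z).prod ν) := by
    refine (integrable_prod_iff hFm.aestronglyMeasurable).2
      ⟨Eventually.of_forall h𝒞.integrable, hdom.mono' ?_ (Eventually.of_forall fun z => ?_)⟩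
    · exact hFm.norm.stronglyMeasurable.integral_prod_right.aestronglyMeasurable
    · rw [Real.norm_eq_abs, abs_of_nonneg (integral_nonneg fun _ => norm_nonneg _)]
      simpa using h𝒞.bound z
  have hpair : Measurable fun w => (Z w, ζ w) := hZm.prodMk hζ
  have hint' : Integrable (fun w => ‖r⁻¹ • 𝒞 (ζ w) (Z w) - Z w‖ ^ 2) μ := by
    rw [← hprod, integrable_map_measure hFm.aestronglyMeasurable hpair.aemeasurable] at hint
    exact hint
  refine ⟨(memLp_two_iff_integrable_sq_norm (hGm.comp hpair).aestronglyMeasurable).2 hint', ?_⟩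
  calc ∫ w, ‖r⁻¹ • 𝒞 (ζ w) (Z w) - Z w‖ ^ 2 ∂μ
      = ∫ p, ‖G p‖ ^ 2 ∂(μ.map fun w => (Z w, ζ w)) :=
        (integral_map hpair.aemeasurable hFm.aestronglyMeasurable).symm
    _ = ∫ z, ∫ y, ‖G (z, y)‖ ^ 2 ∂ν ∂(μ.map Z) := by rw [hprod, integral_prod _ hint]
    _ ≤ ∫ z, ((1 - δ) * ‖z‖ ^ 2 + C) ∂(μ.map Z) :=
        integral_mono hint.integral_prod_left hdom h𝒞.bound
    _ = (1 - δ) * ∫ z, ‖z‖ ^ 2 ∂(μ.map Z) + C := by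
        rw [integral_add (hZsq.const_mul _) (integrable_const _), integral_const_mul]
        simp
    _ = (1 - δ) * ∫ w, ‖Z w‖ ^ 2 ∂μ + C := by
        rw [integral_map hZm.aemeasurable (by fun_prop)]

/-- Convexity of the squared norm: `z - ω • q` is the combination of `z` and `z - r⁻¹ • q` with
weights `1 - ω * r` and `ω * r`. The condition `ω ≤ 1 / r` makes the weights nonnegative. -/
theorem norm_sub_smul_sq_le {r ω : ℝ} (hr : 0 < r) (hω : ω ∈ Set.Ioc 0 (1 / r))
    (z q : EuclideanSpace ℝ (Fin d)) :
    ‖z - ω • q‖ ^ 2 ≤ (1 - ω * r) * ‖z‖ ^ 2 + ω * r * ‖r⁻¹ • q - z‖ ^ 2 := by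
  have h1 : ω * r ≤ 1 := (le_div_iff₀ hr).1 hω.2
  have h0 : 0 < ω * r := mul_pos hω.1 hr
  have e : z - ω • q = (1 - ω * r) • z - (ω * r) • (r⁻¹ • q - z) := by
    rw [smul_sub, smul_smul, mul_assoc, mul_inv_cancel₀ hr.ne', mul_one, sub_smul, one_smul]
    abel
  have hpar : ‖(1 - ω * r) • z - (ω * r) • (r⁻¹ • q - z)‖ ^ 2
      = (1 - ω * r) * ‖z‖ ^ 2 + ω * r * ‖r⁻¹ • q - z‖ ^ 2
        - (1 - ω * r) * (ω * r) * ‖z + (r⁻¹ • q - z)‖ ^ 2 := by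
    rw [norm_sub_sq_real, norm_add_sq_real, norm_smul_sq, norm_smul_sq, inner_smul_left,
      inner_smul_right]
    simp only [RCLike.conj_to_real]
    ring
  rw [e, hpar]
  have : 0 ≤ (1 - ω * r) * (ω * r) * ‖z + (r⁻¹ • q - z)‖ ^ 2 :=
    mul_nonneg (mul_nonneg (by linarith) h0.le) (sq_nonneg _)
  linarith

/-- The compression error contracts in expectation, up to a term proportional to the square of the
scaling. -/
theorem IsGloballyBounded.integral_error_le (h𝒞 : IsGloballyBounded ν 𝒞 r δ C) (hr : 0 < r)
    {ω s : ℝ} (hω : ω ∈ Set.Ioc 0 (1 / r)) (hs : 0 < s)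
    {X H : Ω → EuclideanSpace ℝ (Fin d)} {ζ : Ω → Ξ}
    (hm : Measurable fun w => X w - H w) (hXH : MemLp (fun w => X w - H w) 2 μ)
    (hζ : Measurable ζ) (hlaw : μ.map ζ = ν) (hind : IndepFun (fun w => X w - H w) ζ μ) :
    MemLp (fun w => 𝒞 (ζ w) (s⁻¹ • (X w - H w))) 2 μ ∧
    ∫ w, ‖X w - (H w + (ω * s) • 𝒞 (ζ w) (s⁻¹ • (X w - H w)))‖ ^ 2 ∂μ
      ≤ (1 - ω * r * δ) * ∫ w, ‖X w - H w‖ ^ 2 ∂μ + ω * r * C * s ^ 2 := by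
  set Z : Ω → EuclideanSpace ℝ (Fin d) := fun w => s⁻¹ • (X w - H w) with hZdef
  have hZm : Measurable Z := hm.const_smul s⁻¹
  have hZ : MemLp Z 2 μ := hXH.const_smul s⁻¹
  have hindZ : IndepFun Z ζ μ := hind.comp (measurable_const_smul s⁻¹) measurable_id
  obtain ⟨hR, hbound⟩ := h𝒞.integral_le_of_indepFun hZm hZ hζ hlaw hindZ
  have hq : MemLp (fun w => 𝒞 (ζ w) (Z w)) 2 μ := by
    refine ((hR.add hZ).const_smul r).ae_eq (Eventually.of_forall fun w => ?_)
    simp [smul_smul, hr.ne']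
  refine ⟨hq, ?_⟩
  have hpt : ∀ w, ‖X w - (H w + (ω * s) • 𝒞 (ζ w) (Z w))‖ ^ 2
      ≤ s ^ 2 * ((1 - ω * r) * ‖Z w‖ ^ 2 + ω * r * ‖r⁻¹ • 𝒞 (ζ w) (Z w) - Z w‖ ^ 2) := by
    intro w
    have e : X w - (H w + (ω * s) • 𝒞 (ζ w) (Z w)) = s • (Z w - ω • 𝒞 (ζ w) (Z w)) := by
      have hs' : s • Z w = X w - H w := smul_inv_smul₀ hs.ne' _
      rw [smul_sub, hs', smul_smul, mul_comm s ω]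
      abel
    rw [e, norm_smul_sq]
    exact mul_le_mul_of_nonneg_left (norm_sub_smul_sq_le hr hω _ _) (sq_nonneg s)
  have hZi := integrable_norm_sq hZ
  have hRi := integrable_norm_sq hR
  have hXZ : ∫ w, ‖X w - H w‖ ^ 2 ∂μ = s ^ 2 * ∫ w, ‖Z w‖ ^ 2 ∂μ := by
    rw [← integral_const_mul]
    refine integral_congr_ae (Eventually.of_forall fun w => ?_)
    simp only [hZdef]
    rw [norm_smul_sq]
    field_simp
  have hL : MemLp (fun w => X w - (H w + (ω * s) • 𝒞 (ζ w) (Z w))) 2 μ := by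
    refine (hXH.sub (hq.const_smul (ω * s))).ae_eq (Eventually.of_forall fun w => ?_)
    simp [sub_sub]
  calc _ ≤ ∫ w, s ^ 2 * ((1 - ω * r) * ‖Z w‖ ^ 2
          + ω * r * ‖r⁻¹ • 𝒞 (ζ w) (Z w) - Z w‖ ^ 2) ∂μ :=
        integral_mono (integrable_norm_sq hL)
          (((hZi.const_mul _).add (hRi.const_mul _)).const_mul _) hpt
    _ = s ^ 2 * ((1 - ω * r) * ∫ w, ‖Z w‖ ^ 2 ∂μ
          + ω * r * ∫ w, ‖r⁻¹ • 𝒞 (ζ w) (Z w) - Z w‖ ^ 2 ∂μ) := by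
        rw [integral_const_mul, integral_add (hZi.const_mul _) (hRi.const_mul _),
          integral_const_mul, integral_const_mul]
    _ ≤ s ^ 2 * ((1 - ω * r) * ∫ w, ‖Z w‖ ^ 2 ∂μ
          + ω * r * ((1 - δ) * ∫ w, ‖Z w‖ ^ 2 ∂μ + C)) := by
        have := mul_pos hω.1 hr
        gcongr
    _ = _ := by rw [hXZ]; ring

end Compression

/-! ### Invariants, measurability and moments of the run -/

section Run

variable {n d : ℕ} {Ω Ξ : Type*} {L : Matrix (Fin n) (Fin n) ℝ}
  {f : Fin n → EuclideanSpace ℝ (Fin d) → ℝ}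
  {𝒞 : Ξ → EuclideanSpace ℝ (Fin d) → EuclideanSpace ℝ (Fin d)}
  {α β γ ω ℓ : ℝ} {s : ℕ → ℝ} {x0 : Fin n → EuclideanSpace ℝ (Fin d)}

theorem run_xhat_succ (ζ : ℕ → Fin n → Ξ) (k : ℕ) (i : Fin n) :
    (run L f 𝒞 α β γ ω s x0 ζ (k + 1)).xhat i
      = (run L f 𝒞 α β γ ω s x0 ζ k).xhat i + (ω * s k) • 𝒞 (ζ k i) ((s k)⁻¹ •
        ((run L f 𝒞 α β γ ω s x0 ζ k).x i - (run L f 𝒞 α β γ ω s x0 ζ k).xhat i)) := rfl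

/-- Both sides start at zero and receive the same increments, so `y` can be eliminated from the
analysis. -/
theorem run_y_eq (ζ : ℕ → Fin n → Ξ) (k : ℕ) :
    (run L f 𝒞 α β γ ω s x0 ζ k).y
      = fun i => ∑ j, L i j • (run L f 𝒞 α β γ ω s x0 ζ k).xhat j := by
  induction k with
  | zero => funext i; simp [run]
  | succ k ih =>
    funext i
    have h : (run L f 𝒞 α β γ ω s x0 ζ (k + 1)).y i = (run L f 𝒞 α β γ ω s x0 ζ k).y i
      + (ω * s k) • ∑ j, L i j • message 𝒞 (s k) (ζ k) (run L f 𝒞 α β γ ω s x0 ζ k) j := rfl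
    rw [h, ih]
    simp only [run_xhat_succ, message, smul_add, Finset.sum_add_distrib, Finset.smul_sum]
    congr 1
    exact Finset.sum_congr rfl fun j _ => smul_comm _ _ _

theorem run_x_succ (ζ : ℕ → Fin n → Ξ) (k : ℕ) :
    (run L f 𝒞 α β γ ω s x0 ζ (k + 1)).x = (run L f 𝒞 α β γ ω s x0 ζ k).x
      - α • (β • (fun i => ∑ j, L i j • (run L f 𝒞 α β γ ω s x0 ζ (k + 1)).xhat j)
        + γ • (run L f 𝒞 α β γ ω s x0 ζ k).v
        + fun i => gradient (f i) ((run L f 𝒞 α β γ ω s x0 ζ k).x i)) := by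
  rw [← run_y_eq]
  rfl

theorem run_v_succ (ζ : ℕ → Fin n → Ξ) (k : ℕ) :
    (run L f 𝒞 α β γ ω s x0 ζ (k + 1)).v = (run L f 𝒞 α β γ ω s x0 ζ k).v
      + (α * γ) • fun i => ∑ j, L i j • (run L f 𝒞 α β γ ω s x0 ζ (k + 1)).xhat j := by
  rw [← run_y_eq]
  rfl

theorem run_sum_v (hL : ∀ k, ∑ i, L i k = 0) (ζ : ℕ → Fin n → Ξ) (k : ℕ) :
    ∑ i, (run L f 𝒞 α β γ ω s x0 ζ k).v i = 0 := by
  induction k with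
  | zero => simp [run]
  | succ k ih =>
    rw [run_v_succ]
    simp only [Pi.add_apply, Pi.smul_apply, Finset.sum_add_distrib, ih, zero_add,
      ← Finset.smul_sum]
    rw [Finset.sum_comm]
    simp [← Finset.sum_smul, hL]

/-- The state at the start of iteration `k` is a measurable function of the randomness used
before. -/
theorem measurable_run [MeasurableSpace Ω] [MeasurableSpace Ξ]
    (h𝒞 : Measurable (Function.uncurry 𝒞)) (hf : ∀ i, IsSmoothWith ℓ (f i))
    {ξ : ℕ → Fin n → Ω → Ξ} (k : ℕ) (hξ : ∀ j < k, ∀ i, Measurable (ξ j i)) (i : Fin n) :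
    Measurable (fun w => (run L f 𝒞 α β γ ω s x0 (fun k i => ξ k i w) k).x i) ∧
    Measurable (fun w => (run L f 𝒞 α β γ ω s x0 (fun k i => ξ k i w) k).v i) ∧
    Measurable (fun w => (run L f 𝒞 α β γ ω s x0 (fun k i => ξ k i w) k).xhat i) := by
  induction k generalizing i with
  | zero => exact ⟨measurable_const, measurable_const, measurable_const⟩
  | succ k ih =>
    have ih := ih fun j hj => hξ j (by omega)
    have hxhat : ∀ i, Measurable
        (fun w => (run L f 𝒞 α β γ ω s x0 (fun k i => ξ k i w) (k + 1)).xhat i) := fun i =>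
      (ih i).2.2.add ((h𝒞.comp ((hξ k (by omega) i).prodMk
        (((ih i).1.sub (ih i).2.2).const_smul (s k)⁻¹))).const_smul (ω * s k))
    have hy : Measurable (fun w => ∑ j, L i j •
        (run L f 𝒞 α β γ ω s x0 (fun k i => ξ k i w) (k + 1)).xhat j) :=
      Finset.measurable_fun_sum _ fun j _ => (hxhat j).const_smul (L i j)
    refine ⟨?_, ?_, hxhat i⟩
    · simp only [run_x_succ]
      exact (ih i).1.sub ((((hy.const_smul β).add ((ih i).2.1.const_smul γ)).add
        ((hf i).continuous_gradient.measurable.comp (ih i).1)).const_smul α)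
    · simp only [run_v_succ]
      exact (ih i).2.1.add (hy.const_smul (α * γ))

variable [MeasurableSpace Ω] [MeasurableSpace Ξ] {μ : Measure Ω} {ν : Measure Ξ} {r δ C : ℝ}
  {ξ : ℕ → Fin n → Ω → Ξ}

theorem indepFun_run (h𝒞 : Measurable (Function.uncurry 𝒞)) (hf : ∀ i, IsSmoothWith ℓ (f i))
    (hξ : IsFreshRandomness μ ν ξ) (k : ℕ) (i : Fin n) :
    IndepFun (fun w => (run L f 𝒞 α β γ ω s x0 (fun k i => ξ k i w) k).x i
      - (run L f 𝒞 α β γ ω s x0 (fun k i => ξ k i w) k).xhat i) (ξ k i) μ := by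
  set m : ℕ → MeasurableSpace Ω :=
    fun k => MeasurableSpace.comap (fun w i => ξ k i w) MeasurableSpace.pi with hm
  have hle : ∀ k, m k ≤ ‹MeasurableSpace Ω› := fun k =>
    (measurable_pi_lambda _ fun i => hξ.measurable k i).comap_le
  have hcoord : ∀ k i, Measurable[m k] (ξ k i) := fun k i =>
    (measurable_pi_apply i).comp (comap_measurable (fun w i => ξ k i w))
  have hind := indep_iSup_of_disjoint hle hξ.indep.iIndep
    (Set.disjoint_singleton_right.2 (Set.self_notMem_Iio (a := k)))
  -- `measurable_run` is used with the σ-algebra of the iterations before `k` in place of the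
  -- ambient one; this is what makes the input of the compressor independent of `ξ k i`.
  have hpast := @measurable_run n d Ω Ξ L f 𝒞 α β γ ω ℓ s x0 (⨆ j ∈ Set.Iio k, m j) _ h𝒞 hf ξ k
    (fun j hj i => (hcoord j i).mono (le_iSup₂ (f := fun j (_ : j ∈ Set.Iio k) => m j) j hj) le_rfl)
    i
  refine indep_of_indep_of_le_left (indep_of_indep_of_le_right hind ?_) ?_
  · exact ((hcoord k i).mono (le_iSup₂ (f := fun j (_ : j ∈ ({k} : Set ℕ)) => m j) k rfl)
      le_rfl).comap_le
  · exact (hpast.1.sub hpast.2.2).comap_le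

variable [IsProbabilityMeasure μ] [IsProbabilityMeasure ν]

theorem memLp_run (h𝒞 : IsGloballyBounded ν 𝒞 r δ C) (hr : 0 < r) (hω : ω ∈ Set.Ioc 0 (1 / r))
    (hs : ∀ k, 0 < s k) (hf : ∀ i, IsSmoothWith ℓ (f i)) (hξ : IsFreshRandomness μ ν ξ) (k : ℕ)
    (i : Fin n) :
    MemLp (fun w => (run L f 𝒞 α β γ ω s x0 (fun k i => ξ k i w) k).x i) 2 μ ∧
    MemLp (fun w => (run L f 𝒞 α β γ ω s x0 (fun k i => ξ k i w) k).v i) 2 μ ∧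
    MemLp (fun w => (run L f 𝒞 α β γ ω s x0 (fun k i => ξ k i w) k).xhat i) 2 μ := by
  induction k generalizing i with
  | zero => exact ⟨memLp_const _, memLp_const _, memLp_const _⟩
  | succ k ih =>
    have hxhat : ∀ i, MemLp
        (fun w => (run L f 𝒞 α β γ ω s x0 (fun k i => ξ k i w) (k + 1)).xhat i) 2 μ := by
      intro i
      have hmeas := measurable_run (L := L) (α := α) (β := β) (γ := γ) (ω := ω) (s := s)
        (x0 := x0) h𝒞.measurable hf k (fun j _ => hξ.measurable j) i
      exact (ih i).2.2.add ((h𝒞.integral_error_le hr hω (hs k) (hmeas.1.sub hmeas.2.2)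
        ((ih i).1.sub (ih i).2.2) (hξ.measurable k i) (hξ.law k i)
        (indepFun_run h𝒞.measurable hf hξ k i)).1.const_smul (ω * s k))
    have hy : MemLp (fun w => ∑ j, L i j •
        (run L f 𝒞 α β γ ω s x0 (fun k i => ξ k i w) (k + 1)).xhat j) 2 μ :=
      memLp_finsetSum _ fun j _ => (hxhat j).const_smul (L i j)
    refine ⟨?_, ?_, hxhat i⟩
    · simp only [run_x_succ]
      exact (ih i).1.sub ((((hy.const_smul β).add ((ih i).2.1.const_smul γ)).add
        ((hf i).memLp_gradient (ih i).1)).const_smul α)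
    · simp only [run_v_succ]
      exact (ih i).2.1.add (hy.const_smul (α * γ))

theorem integral_run_error_le (h𝒞 : IsGloballyBounded ν 𝒞 r δ C) (hr : 0 < r)
    (hω : ω ∈ Set.Ioc 0 (1 / r)) (hs : ∀ k, 0 < s k) (hf : ∀ i, IsSmoothWith ℓ (f i))
    (hξ : IsFreshRandomness μ ν ξ) (k : ℕ) (i : Fin n) :
    ∫ w, ‖(run L f 𝒞 α β γ ω s x0 (fun k i => ξ k i w) k).x i
        - (run L f 𝒞 α β γ ω s x0 (fun k i => ξ k i w) (k + 1)).xhat i‖ ^ 2 ∂μ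
      ≤ (1 - ω * r * δ) * ∫ w, ‖(run L f 𝒞 α β γ ω s x0 (fun k i => ξ k i w) k).x i
        - (run L f 𝒞 α β γ ω s x0 (fun k i => ξ k i w) k).xhat i‖ ^ 2 ∂μ
        + ω * r * C * s k ^ 2 := by
  have hmeas := measurable_run (L := L) (α := α) (β := β) (γ := γ) (ω := ω) (s := s)
    (x0 := x0) h𝒞.measurable hf k (fun j _ => hξ.measurable j) i
  have hL := memLp_run (L := L) (α := α) (β := β) (γ := γ) (x0 := x0) h𝒞 hr hω hs hf hξ k i
  exact (h𝒞.integral_error_le hr hω (hs k) (hmeas.1.sub hmeas.2.2)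
    (hL.1.sub hL.2.2) (hξ.measurable k i) (hξ.law k i)
    (indepFun_run h𝒞.measurable hf hξ k i)).2

end Run

/-! ### Consequences of the parameter conditions -/

section Thresholds

variable {ρ l₂ ℓ α β γ ω r δ τ : ℝ}

theorem epsNine_mem (hr : 0 < r) (hδ : δ ∈ Set.Ioc (0 : ℝ) 1) (hω : ω ∈ Set.Ioc 0 (1 / r)) :
    epsNine ω r δ ∈ Set.Ioc (0 : ℝ) (1 / 2) := by
  have h1 : ω * r ≤ 1 := (le_div_iff₀ hr).1 hω.2
  have h0 : 0 < ω * r := mul_pos hω.1 hr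
  unfold epsNine
  constructor
  · have := mul_pos h0 hδ.1
    positivity
  · have := mul_le_mul h1 hδ.2 hδ.1.le zero_le_one
    linarith

theorem epsTen_nonneg (hr : 0 < r) (hδ : δ ∈ Set.Ioc (0 : ℝ) 1) (hω : ω ∈ Set.Ioc 0 (1 / r)) :
    0 ≤ epsTen ω r δ := by
  obtain ⟨h0, h1⟩ := epsNine_mem hr hδ hω
  exact mul_nonneg (by linarith) (by positivity)

theorem two_lt_of_kappaTwo_lt (hγ : kappaTwo l₂ ℓ < γ) : 2 < γ := by
  have h : 2 + 2 * ℓ ^ 2 ≤ kappaTwo l₂ ℓ := (le_max_left _ _).trans (le_max_left _ _)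
  nlinarith [sq_nonneg ℓ]

theorem four_mul_le_of_kappaOne_le (hl₂ : 0 < l₂) (hγ : 0 < γ) (hτ : kappaOne l₂ ≤ τ) :
    4 * γ ≤ l₂ * (τ * γ) := by
  rw [kappaOne, div_le_iff₀ hl₂] at hτ
  nlinarith

/-- What the bound on the stepsize gives for the coefficients in the descent inequality. -/
theorem coefficients_of_lt_stepsizeBound (hl₂ : 0 < l₂) (hρ : l₂ ≤ ρ) (hℓ : 0 < ℓ) (hγ : 2 < γ)
    (hβ : 4 * γ ≤ l₂ * β) (hc : 0 ≤ epsTen ω r δ)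
    (hα : α ∈ Set.Ioo 0 (stepsizeBound ρ l₂ ℓ β γ ω r δ)) :
    α * phiFour' ρ γ (epsTen ω r δ) ≤ phiThree l₂ γ ∧
    α * phiSix l₂ ℓ β γ + α * epsTen ω r δ ≤ phiFive l₂ ℓ β γ + 3 / 8 ∧
    0 ≤ phiSeven ρ β γ + α * phiEight' ρ l₂ β γ (epsTen ω r δ) ∧
    0 < α * phiOne l₂ ℓ β γ - α ^ 2 * phiTwo' ρ l₂ ℓ β γ (epsTen ω r δ) ∧
    α * phiSeven ρ β γ + α ^ 2 * phiEight' ρ l₂ β γ (epsTen ω r δ) ≤ 2 * epsTwelve ω r δ := by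
  obtain ⟨hα0, hα1⟩ := hα
  simp only [stepsizeBound, lt_min_iff] at hα1
  obtain ⟨⟨h12, h34⟩, h56, h78⟩ := hα1
  set c := epsTen ω r δ
  have hγ0 : 0 < γ := by linarith
  have hρ0 : 0 < ρ := hl₂.trans_le hρ
  have hβ0 : 0 < β := by
    by_contra h
    nlinarith [mul_nonneg hl₂.le (neg_nonneg.2 (not_lt.1 h))]
  have hlβ : l₂ * β ≤ ρ * β := by gcongr
  have hργ : 4 * γ ≤ ρ * β := hβ.trans hlβ
  have hβγ : l₂ * β * γ ≤ ρ ^ 2 * β ^ 2 := by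
    nlinarith [mul_le_mul hlβ hργ (by positivity) (by positivity), mul_pos (mul_pos hl₂ hβ0) hγ0]
  have hβγ' : 0 < l₂ * β * γ := by positivity
  have hφ₂ : 4 * c * (ρ ^ 2 * β ^ 2) < phiTwo' ρ l₂ ℓ β γ c := by
    have h1 : 0 ≤ (ρ + 2) * γ ^ 2 := by positivity
    have h2 : 0 ≤ (5 / 2 + 4 * c) * ℓ ^ 2 := by positivity
    have h3 : 0 ≤ ρ ^ 2 * β ^ 2 := by positivity
    unfold phiTwo'
    linarith
  have hφ₂0 : 0 < phiTwo' ρ l₂ ℓ β γ c := lt_of_le_of_lt (by positivity) hφ₂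
  have hφ₄ : 0 < phiFour' ρ γ c := by unfold phiFour'; positivity
  have hφ₆ : 0 < phiSix l₂ ℓ β γ := by unfold phiSix; positivity
  have hφ₇ : 0 < phiSeven ρ β γ := by unfold phiSeven; positivity
  have hφ₈ : 0 < phiEight' ρ l₂ β γ c := by
    have h1 : 0 ≤ (ρ + 2) * γ ^ 2 := by positivity
    have h2 : 0 ≤ c * (ρ ^ 2 * β ^ 2) := by positivity
    have h3 : 0 ≤ ρ * β * γ := by positivity
    unfold phiEight'
    linarith
  -- Once the denominators are positive, the numerators need no separate sign analysis: a positive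
  -- `α` lies below each quotient.
  rw [lt_div_iff₀ hφ₂0] at h12
  rw [lt_div_iff₀ hφ₄] at h34
  rw [lt_div_iff₀ hφ₆] at h56
  rw [lt_div_iff₀ (by positivity)] at h78
  -- `phiSix` makes no allowance for `c`, so `α * c` is bounded through the first quotient:
  -- `phiTwo'` exceeds `4 * c * (ρ * β) ^ 2`, `phiOne` is at most `ρ * β / 2`, and `ρ * β ≥ 4 * γ >
  -- 8`.
  have hcα : α * c ≤ 3 / 8 := by
    have h1 : α * (4 * c * (ρ ^ 2 * β ^ 2)) ≤ ρ * β / 2 := by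
      refine ((mul_le_mul_of_nonneg_left hφ₂.le hα0.le).trans h12.le).trans ?_
      unfold phiOne
      nlinarith [sq_nonneg ℓ]
    have hρβ : 0 < ρ * β := by positivity
    have h2 : 8 * (α * c) * (ρ * β) ≤ 1 := by
      refine le_of_mul_le_mul_right ?_ hρβ
      linarith
    have h3 : 8 * (α * c) * 8 ≤ 8 * (α * c) * (ρ * β) :=
      mul_le_mul_of_nonneg_left (by linarith) (by positivity)
    linarith
  refine ⟨h34.le, by linarith, by positivity, ?_, ?_⟩
  · have := mul_pos hα0 (sub_pos.2 h12)
    linarith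
  · set φ := phiEight' ρ l₂ β γ c
    set ψ := phiSeven ρ β γ
    -- The last quotient is the positive root of `φ * t ^ 2 + ψ * t = 2 * epsTwelve ω r δ`; squaring
    -- recovers the inequality for `α` below it.
    have h1 : α * (2 * φ) + ψ < √(ψ ^ 2 + 8 * epsTwelve ω r δ * φ) := by linarith
    have h2 := (Real.lt_sqrt (by positivity)).1 h1
    refine le_of_mul_le_mul_right ?_ (by positivity : 0 < 4 * φ)
    linarith

end Thresholds

/-! ### Decrease of the potential in expectation -/

section Convergence

theorem add_sum_le_of_step_le {U D : ℕ → ℝ} {K q : ℝ} (hK : 0 ≤ K) (hq0 : 0 ≤ q) (hq1 : q < 1)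
    (h : ∀ k, U (k + 1) ≤ U k - D k + K * q ^ k) (T : ℕ) :
    U T + ∑ k ∈ Finset.range T, D k ≤ U 0 + K * (1 - q)⁻¹ := by
  have h1 : U T + ∑ k ∈ Finset.range T, D k ≤ U 0 + K * ∑ k ∈ Finset.range T, q ^ k := by
    induction T with
    | zero => simp
    | succ T ih =>
      rw [Finset.sum_range_succ, Finset.sum_range_succ]
      linarith [h T]
  refine h1.trans ?_
  gcongr
  exact (Summable.sum_le_tsum _ (fun k _ => pow_nonneg hq0 k)
    (summable_geometric_of_lt_one hq0 hq1)).trans_eq (tsum_geometric_of_lt_one hq0 hq1)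

variable {n d : ℕ} {Ω Ξ : Type*} [MeasurableSpace Ω] [MeasurableSpace Ξ]
  {μ : Measure Ω} {ν : Measure Ξ}
  {L : Matrix (Fin n) (Fin n) ℝ} {f : Fin n → EuclideanSpace ℝ (Fin d) → ℝ}
  {𝒞 : Ξ → EuclideanSpace ℝ (Fin d) → EuclideanSpace ℝ (Fin d)}
  {α β γ ω ℓ m r δ C l₂ ρ : ℝ} {s : ℕ → ℝ} {x0 : Fin n → EuclideanSpace ℝ (Fin d)}
  {ξ : ℕ → Fin n → Ω → Ξ} {J : Finset (Fin n)} {b : Fin n → EuclideanSpace ℝ (Fin n)}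
  {l : Fin n → ℝ}

/-- The expected Lyapunov function at iteration `k`, including the compression error. -/
noncomputable def potential (μ : Measure Ω) (f : Fin n → EuclideanSpace ℝ (Fin d) → ℝ) (β γ : ℝ)
    (J : Finset (Fin n)) (b : Fin n → EuclideanSpace ℝ (Fin n)) (l : Fin n → ℝ) (m : ℝ)
    (S : Ω → ℕ → State n d) (k : ℕ) : ℝ :=
  ∫ w, lyapunov f β γ J b l m (S w k).x (S w k).v ∂μ
    + ∑ i, ∫ w, ‖(S w k).x i - (S w (k + 1)).xhat i‖ ^ 2 ∂μ

theorem norm_add_sq_le_weighted {E : Type*} [NormedAddCommGroup E] [InnerProductSpace ℝ E]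
    {c : ℝ} (hc : 0 < c) (x y : E) :
    ‖x + y‖ ^ 2 ≤ (1 + c) * ‖x‖ ^ 2 + (1 + c⁻¹) * ‖y‖ ^ 2 := by
  have h := inner_le_weighted c hc x y
  rw [norm_add_sq_real]
  have : 1 / (2 * c) = c⁻¹ / 2 := by field_simp
  rw [this] at h
  linarith

theorem integral_le_of_forall_le {V V' M D G R : Ω → ℝ} {c p q κ : ℝ} (hV : Integrable V μ)
    (hV' : Integrable V' μ) (hM : Integrable M μ) (hD : Integrable D μ) (hG : Integrable G μ)
    (hR : Integrable R μ)
    (h : ∀ w, V' w + c * M w ≤ V w - p * D w - q * G w + κ * R w) :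
    ∫ w, V' w ∂μ + c * ∫ w, M w ∂μ
      ≤ ∫ w, V w ∂μ - p * ∫ w, D w ∂μ - q * ∫ w, G w ∂μ + κ * ∫ w, R w ∂μ := by
  have h1 : Integrable (fun w => V w - p * D w) μ := hV.sub (hD.const_mul p)
  have h2 : Integrable (fun w => V w - p * D w - q * G w) μ := h1.sub (hG.const_mul q)
  have h3 := integral_mono (hV'.add (hM.const_mul c)) (h2.add (hR.const_mul κ)) h
  rw [integral_add' hV' (hM.const_mul c), integral_add' h2 (hR.const_mul κ),
    integral_sub h1 (hG.const_mul q), integral_sub hV (hD.const_mul p)] at h3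
  simpa only [integral_const_mul] using h3

/-- The squared move appears on the left of the Lyapunov inequality and on the right of the
compression inequality with the same coefficient `epsTen`, so it cancels when they are added. The
error keeps the coefficient `1 - 2 * epsTwelve + κ ≤ 1`. -/
theorem potential_step_le [IsProbabilityMeasure μ] [IsProbabilityMeasure ν]
    (hM : IsModeSystem d L l₂ ρ J b l) (hn : n ≠ 0)
    (hf : ∀ i, IsSmoothWith ℓ (f i)) (hm : ∀ z, m ≤ globalCost f z) (hα : 0 < α) (hγ : 0 < γ)
    (hβ : 4 * γ ≤ l₂ * β) (h𝒞 : IsGloballyBounded ν 𝒞 r δ C) (hr : 0 < r)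
    (hδ : δ ∈ Set.Ioc (0 : ℝ) 1) (hω : ω ∈ Set.Ioc 0 (1 / r)) (hs : ∀ k, 0 < s k)
    (hξ : IsFreshRandomness μ ν ξ)
    (h34 : α * phiFour' ρ γ (epsTen ω r δ) ≤ phiThree l₂ γ)
    (h56 : α * phiSix l₂ ℓ β γ + α * epsTen ω r δ ≤ phiFive l₂ ℓ β γ + 3 / 8)
    (h78 : 0 ≤ phiSeven ρ β γ + α * phiEight' ρ l₂ β γ (epsTen ω r δ))
    (h78' : α * phiSeven ρ β γ + α ^ 2 * phiEight' ρ l₂ β γ (epsTen ω r δ) ≤ 2 * epsTwelve ω r δ)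
    {S : Ω → ℕ → State n d}
    (hS : S = fun w => run L f 𝒞 α β γ ω s x0 (fun k i => ξ k i w)) (k : ℕ) :
    potential μ f β γ J b l m S (k + 1) ≤ potential μ f β γ J b l m S k
      - ((α * phiOne l₂ ℓ β γ - α ^ 2 * phiTwo' ρ l₂ ℓ β γ (epsTen ω r δ))
          * ∫ w, ∑ i, ‖(S w k).x i - avg (S w k).x‖ ^ 2 ∂μ
        + α / 2 * (n * ∫ w, ‖gradient (globalCost f) (avg (S w k).x)‖ ^ 2 ∂μ))
      + n * (ω * r * C * s (k + 1) ^ 2) := by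
  have hLp : ∀ k i, MemLp (fun w => (S w k).x i) 2 μ ∧ MemLp (fun w => (S w k).v i) 2 μ ∧
      MemLp (fun w => (S w k).xhat i) 2 μ := by
    intro k i
    rw [hS]
    exact memLp_run h𝒞 hr hω hs hf hξ k i
  have hc := epsTen_nonneg hr hδ hω
  obtain ⟨h90, h91⟩ := epsNine_mem hr hδ hω
  set c := epsTen ω r δ with hcdef
  set κ := α * phiSeven ρ β γ + α ^ 2 * phiEight' ρ l₂ β γ c
  have hV : ∀ k, Integrable (fun w => lyapunov f β γ J b l m (S w k).x (S w k).v) μ := fun k =>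
    integrable_lyapunov hn hf hm β γ J b l (fun i => (hLp k i).1) (fun i => (hLp k i).2.1)
  have hmove : ∀ i, Integrable (fun w => ‖(S w (k + 1)).x i - (S w k).x i‖ ^ 2) μ := fun i =>
    integrable_norm_sq ((hLp (k + 1) i).1.sub (hLp k i).1)
  have herr : ∀ i, Integrable (fun w => ‖(S w k).x i - (S w (k + 1)).xhat i‖ ^ 2) μ := fun i =>
    integrable_norm_sq ((hLp k i).1.sub (hLp (k + 1) i).2.2)
  have hdev : Integrable (fun w => ∑ i, ‖(S w k).x i - avg (S w k).x‖ ^ 2) μ :=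
    integrable_finsetSum _ fun i _ =>
      integrable_norm_sq ((hLp k i).1.sub (memLp_avg fun i => (hLp k i).1))
  have hgr : Integrable (fun w => ‖gradient (globalCost f) (avg (S w k).x)‖ ^ 2) μ :=
    integrable_norm_sq ((isSmoothWith_globalCost hn hf).memLp_gradient
      (memLp_avg fun i => (hLp k i).1))
  have hstep : ∀ w, lyapunov f β γ J b l m (S w (k + 1)).x (S w (k + 1)).v
        + c * ∑ i, ‖(S w (k + 1)).x i - (S w k).x i‖ ^ 2
      ≤ lyapunov f β γ J b l m (S w k).x (S w k).v
        - (α * phiOne l₂ ℓ β γ - α ^ 2 * phiTwo' ρ l₂ ℓ β γ c)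
          * ∑ i, ‖(S w k).x i - avg (S w k).x‖ ^ 2
        - α / 2 * (n * ‖gradient (globalCost f) (avg (S w k).x)‖ ^ 2)
        + κ * ∑ i, ‖(S w k).x i - (S w (k + 1)).xhat i‖ ^ 2 := by
    intro w
    rw [hS]
    exact lyapunov_step_le hM hn hf hα hγ hβ hc h34 h56 h78 (run_sum_v hM.col_sum _ k)
      (run_x_succ _ k) (run_v_succ _ k)
  have hint := integral_le_of_forall_le (hV k) (hV (k + 1))
    (integrable_finsetSum _ fun i _ => hmove i) hdev (hgr.const_mul (n : ℝ)) (integrable_finsetSum _ fun i _ => herr i) hstep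
  rw [integral_const_mul, integral_finsetSum _ (fun i _ => hmove i),
    integral_finsetSum _ (fun i _ => herr i)] at hint
  -- A state holds the estimate of the previous iteration, so `(S w (k + 1)).xhat` is `x̂_k`, and
  -- the error attached to `x_{k+1}` involves the state `k + 1 + 1`.
  have hcomp : ∀ i ∈ Finset.univ, ∫ w, ‖(S w (k + 1)).x i - (S w (k + 1 + 1)).xhat i‖ ^ 2 ∂μ
      ≤ (1 - 2 * epsTwelve ω r δ) * ∫ w, ‖(S w k).x i - (S w (k + 1)).xhat i‖ ^ 2 ∂μ
        + c * ∫ w, ‖(S w (k + 1)).x i - (S w k).x i‖ ^ 2 ∂μ + ω * r * C * s (k + 1) ^ 2 := by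
    intro i _
    have h1 : ∫ w, ‖(S w (k + 1)).x i - (S w (k + 1 + 1)).xhat i‖ ^ 2 ∂μ
        ≤ (1 - ω * r * δ) * ∫ w, ‖(S w (k + 1)).x i - (S w (k + 1)).xhat i‖ ^ 2 ∂μ
          + ω * r * C * s (k + 1) ^ 2 := by
      rw [hS]
      exact integral_run_error_le h𝒞 hr hω hs hf hξ (k + 1) i
    have h2 : ∫ w, ‖(S w (k + 1)).x i - (S w (k + 1)).xhat i‖ ^ 2 ∂μ
        ≤ (1 + epsNine ω r δ) * ∫ w, ‖(S w k).x i - (S w (k + 1)).xhat i‖ ^ 2 ∂μ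
          + (1 + (epsNine ω r δ)⁻¹) * ∫ w, ‖(S w (k + 1)).x i - (S w k).x i‖ ^ 2 ∂μ := by
      rw [← integral_const_mul, ← integral_const_mul,
        ← integral_add ((herr i).const_mul _) ((hmove i).const_mul _)]
      refine integral_mono (integrable_norm_sq ((hLp (k + 1) i).1.sub (hLp (k + 1) i).2.2))
        (((herr i).const_mul _).add ((hmove i).const_mul _)) fun w => ?_
      have h := norm_add_sq_le_weighted h90 ((S w k).x i - (S w (k + 1)).xhat i)
        ((S w (k + 1)).x i - (S w k).x i)
      rwa [add_comm, sub_add_sub_cancel] at h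
    have h9 : ω * r * δ = 2 * epsNine ω r δ := by unfold epsNine; ring
    rw [h9] at h1
    -- `(1 - 2 * ε₉) * (1 + ε₉) = 1 - 2 * ε₁₂`, and the coefficient of the move becomes `(1 - 2 *
    -- ε₉) * (1 + ε₉⁻¹) = ε₁₀`.
    have h3 := mul_le_mul_of_nonneg_left h2 (by linarith : 0 ≤ 1 - 2 * epsNine ω r δ)
    rw [hcdef]
    unfold epsTwelve epsTen
    linarith
  have hcs := Finset.sum_le_sum hcomp
  simp only [Finset.sum_add_distrib, ← Finset.mul_sum, Finset.sum_const, Finset.card_univ,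
    Fintype.card_fin, nsmul_eq_mul] at hcs
  have hA : 0 ≤ ∑ i, ∫ w, ‖(S w k).x i - (S w (k + 1)).xhat i‖ ^ 2 ∂μ :=
    Finset.sum_nonneg fun i _ => integral_nonneg fun w => sq_nonneg _
  have hκ := mul_le_mul_of_nonneg_right h78' hA
  unfold potential
  linarith

end Convergence

end CompressedOpt

/-! ### The main theorem -/

theorem theorem4 {n d : ℕ} (hn : 2 ≤ n)
    {Ω Ξ : Type*} [MeasurableSpace Ω] [MeasurableSpace Ξ]
    (μ : Measure Ω) [IsProbabilityMeasure μ] (ν : Measure Ξ) [IsProbabilityMeasure ν]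
    -- communication graph
    (A : Matrix (Fin n) (Fin n) ℝ) (hA : CompressedOpt.IsConnectedWeights A)
    (L : Matrix (Fin n) (Fin n) ℝ) (hL : L = CompressedOpt.laplacian A)
    -- cost functions
    (f : Fin n → EuclideanSpace ℝ (Fin d) → ℝ) (ℓ : ℝ) (hℓ : 0 < ℓ)
    (hf : ∀ i, CompressedOpt.IsSmoothWith ℓ (f i))
    (hbdd : BddBelow (Set.range (CompressedOpt.globalCost f)))
    -- compressor and its internal randomness
    (𝒞 : Ξ → EuclideanSpace ℝ (Fin d) → EuclideanSpace ℝ (Fin d)) (r δ C : ℝ)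
    (hr : 0 < r) (hδ : δ ∈ Set.Ioc (0 : ℝ) 1) (hC : 0 < C)
    (h𝒞 : CompressedOpt.IsGloballyBounded ν 𝒞 r δ C)
    (ξ : ℕ → Fin n → Ω → Ξ) (hξ : CompressedOpt.IsFreshRandomness μ ν ξ)
    -- algorithm parameters
    (x0 : Fin n → EuclideanSpace ℝ (Fin d)) (α β γ ω τ₁ s₀ ε : ℝ) (p : ℝ≥0∞) (hp : 1 ≤ p)
    (hτ₁ : CompressedOpt.kappaOne (CompressedOpt.rhoTwo L) ≤ τ₁)
    (hγ : CompressedOpt.kappaTwo (CompressedOpt.rhoTwo L) ℓ < γ)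
    (hβ : β = τ₁ * γ)
    (hω : ω ∈ Set.Ioc 0 (1 / r))
    (hα : α ∈ Set.Ioo 0 (CompressedOpt.stepsizeBound (CompressedOpt.rho L)
      (CompressedOpt.rhoTwo L) ℓ β γ ω r δ))
    (hs₀ : 0 < s₀) (hs₀' : ∀ i, ‖WithLp.toLp p (x0 i).ofLp‖ ≤ s₀)
    (hε : ε ∈ Set.Ioo (0 : ℝ) 1)
    -- the random iterates generated by the algorithm with `s_k = s₀ ε ^ k`, and their average
    (x : ℕ → Ω → Fin n → EuclideanSpace ℝ (Fin d))
    (hx : ∀ k w, x k w = (CompressedOpt.run L f 𝒞 α β γ ω (fun k => s₀ * ε ^ k) x0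
      (fun k i => ξ k i w) k).x)
    (xbar : ℕ → Ω → EuclideanSpace ℝ (Fin d))
    (hxbar : ∀ k w, xbar k w = CompressedOpt.avg (x k w)) :
    (∀ k, Integrable (fun w => ‖gradient (CompressedOpt.globalCost f) (xbar k w)‖ ^ 2
        + 1 / (n : ℝ) * ∑ i, ‖x k w i - xbar k w‖ ^ 2) μ) ∧
    (fun T : ℕ => 1 / (T : ℝ) * ∑ k ∈ Finset.range T,
        ∫ w, (‖gradient (CompressedOpt.globalCost f) (xbar k w)‖ ^ 2
          + 1 / (n : ℝ) * ∑ i, ‖x k w i - xbar k w‖ ^ 2) ∂μ)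
      =O[atTop] (fun T : ℕ => 1 / (T : ℝ)) ∧
    (∀ T, Integrable (fun w => CompressedOpt.globalCost f (xbar T w)
        - ⨅ z, CompressedOpt.globalCost f z) μ) ∧
    (fun T : ℕ => ∫ w, (CompressedOpt.globalCost f (xbar T w)
        - ⨅ z, CompressedOpt.globalCost f z) ∂μ)
      =O[atTop] (fun _ : ℕ => (1 : ℝ)) := by
  subst hL
  have hn0 : n ≠ 0 := by omega
  have hnpos : (0 : ℝ) < n := by positivity
  obtain ⟨J, b, l, hM⟩ := hA.exists_isModeSystem (d := d) hn
  set L := CompressedOpt.laplacian A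
  have hγ2 := CompressedOpt.two_lt_of_kappaTwo_lt hγ
  have hγ0 : 0 < γ := by linarith
  have hβ4 : 4 * γ ≤ CompressedOpt.rhoTwo L * β :=
    hβ ▸ CompressedOpt.four_mul_le_of_kappaOne_le hM.pos hγ0 hτ₁
  have hρ : CompressedOpt.rhoTwo L ≤ CompressedOpt.rho L := by
    obtain ⟨j, hj⟩ := hM.nonempty
    exact (hM.lower j hj).trans (hM.upper j hj)
  have hs : ∀ k, 0 < s₀ * ε ^ k := fun k => mul_pos hs₀ (pow_pos hε.1 k)
  obtain ⟨h34, h56, h78, h12, h78'⟩ := CompressedOpt.coefficients_of_lt_stepsizeBound hM.pos hρ hℓ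
    hγ2 hβ4 (CompressedOpt.epsTen_nonneg hr hδ hω) hα
  set c₁ := α * CompressedOpt.phiOne (CompressedOpt.rhoTwo L) ℓ β γ
    - α ^ 2 * CompressedOpt.phiTwo' (CompressedOpt.rho L) (CompressedOpt.rhoTwo L) ℓ β γ
      (CompressedOpt.epsTen ω r δ)
  set m := ⨅ z, CompressedOpt.globalCost f z with hmdef
  have hm : ∀ z, m ≤ CompressedOpt.globalCost f z := fun z => ciInf_le hbdd z
  set S : Ω → ℕ → CompressedOpt.State n d := fun w =>
    CompressedOpt.run L f 𝒞 α β γ ω (fun k => s₀ * ε ^ k) x0 (fun k i => ξ k i w) with hS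
  have hxS : ∀ k w, x k w = (S w k).x := hx
  have hbarS : ∀ k w, xbar k w = CompressedOpt.avg (S w k).x := fun k w => by rw [hxbar, hxS]
  simp only [hbarS, hxS]
  have hLp : ∀ k i, MemLp (fun w => (S w k).x i) 2 μ ∧ MemLp (fun w => (S w k).v i) 2 μ ∧
      MemLp (fun w => (S w k).xhat i) 2 μ := fun k i =>
    CompressedOpt.memLp_run h𝒞 hr hω hs hf hξ k i
  have hsmooth := CompressedOpt.isSmoothWith_globalCost hn0 hf
  have hdev : ∀ k, Integrable (fun w => ∑ i, ‖(S w k).x i - CompressedOpt.avg (S w k).x‖ ^ 2) μ :=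
    fun k => integrable_finsetSum _ fun i _ => CompressedOpt.integrable_norm_sq
      ((hLp k i).1.sub (CompressedOpt.memLp_avg fun i => (hLp k i).1))
  have hgr : ∀ k, Integrable (fun w =>
      ‖gradient (CompressedOpt.globalCost f) (CompressedOpt.avg (S w k).x)‖ ^ 2) μ := fun k =>
    CompressedOpt.integrable_norm_sq (hsmooth.memLp_gradient
      (CompressedOpt.memLp_avg fun i => (hLp k i).1))
  have hcost : ∀ k, Integrable (fun w =>
      CompressedOpt.globalCost f (CompressedOpt.avg (S w k).x) - m) μ := fun k =>
    hsmooth.integrable_sub_const hm (CompressedOpt.memLp_avg fun i => (hLp k i).1)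
  set Dv : ℕ → ℝ := fun k => ∫ w, ∑ i, ‖(S w k).x i - CompressedOpt.avg (S w k).x‖ ^ 2 ∂μ with hDv
  set G : ℕ → ℝ := fun k =>
    ∫ w, ‖gradient (CompressedOpt.globalCost f) (CompressedOpt.avg (S w k).x)‖ ^ 2 ∂μ with hG
  have hDv0 : ∀ k, 0 ≤ Dv k := fun k =>
    integral_nonneg fun w => Finset.sum_nonneg fun i _ => sq_nonneg _
  have hG0 : ∀ k, 0 ≤ G k := fun k => integral_nonneg fun w => sq_nonneg _
  have hΦ : ∀ k, ∫ w, (‖gradient (CompressedOpt.globalCost f) (CompressedOpt.avg (S w k).x)‖ ^ 2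
      + 1 / (n : ℝ) * ∑ i, ‖(S w k).x i - CompressedOpt.avg (S w k).x‖ ^ 2) ∂μ
      = G k + 1 / (n : ℝ) * Dv k := by
    intro k
    rw [integral_add (hgr k) ((hdev k).const_mul _), integral_const_mul]
  have hωr := mul_pos hω.1 hr
  have hstep : ∀ k, CompressedOpt.potential μ f β γ J b l m S (k + 1)
      ≤ CompressedOpt.potential μ f β γ J b l m S k - (c₁ * Dv k + α / 2 * (n * G k))
        + n * (ω * r * C * (s₀ * ε) ^ 2) * (ε ^ 2) ^ k := by
    intro k
    refine (CompressedOpt.potential_step_le hM hn0 hf hm hα.1 hγ0 hβ4 h𝒞 hr hδ hω hs hξ h34 h56 h78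
      h78' hS k).trans_eq ?_
    congr 1
    ring
  -- The forcing at step `k` is proportional to `s_{k+1} ^ 2 = (s₀ * ε) ^ 2 * (ε ^ 2) ^ k`, a
  -- summable geometric sequence.
  have hsum := CompressedOpt.add_sum_le_of_step_le (by positivity) (sq_nonneg ε)
    (pow_lt_one₀ hε.1.le hε.2 two_ne_zero) hstep
  set B := CompressedOpt.potential μ f β γ J b l m S 0
    + n * (ω * r * C * (s₀ * ε) ^ 2) * (1 - ε ^ 2)⁻¹
  have hD0 : ∀ k, 0 ≤ c₁ * Dv k + α / 2 * (n * G k) := fun k =>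
    add_nonneg (mul_nonneg h12.le (hDv0 k))
      (mul_nonneg (half_pos hα.1).le (mul_nonneg hnpos.le (hG0 k)))
  have hcost0 : ∀ T, 0 ≤ ∫ w, (CompressedOpt.globalCost f (CompressedOpt.avg (S w T).x) - m) ∂μ :=
    fun T => integral_nonneg fun w => sub_nonneg.2 (hm _)
  have hpot : ∀ T, n * ∫ w, (CompressedOpt.globalCost f (CompressedOpt.avg (S w T).x) - m) ∂μ
      ≤ CompressedOpt.potential μ f β γ J b l m S T := by
    intro T
    rw [← integral_const_mul]
    refine (integral_mono ((hcost T).const_mul _) (CompressedOpt.integrable_lyapunov hn0 hf hm β γ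
      J b l (fun i => (hLp T i).1) (fun i => (hLp T i).2.1))
      fun w => CompressedOpt.le_lyapunov hM hγ0 hβ4 _ _).trans ?_
    exact le_add_of_nonneg_right
      (Finset.sum_nonneg fun i _ => integral_nonneg fun w => sq_nonneg _)
  refine ⟨fun k => (hgr k).add ((hdev k).const_mul _), ?_, hcost, ?_⟩
  · simp only [hΦ]
    -- The largest constant for which `a * (G k + Dv k / n)` is dominated term by term by the
    -- dissipation `c₁ * Dv k + α / 2 * (n * G k)`.
    set a := min (c₁ * n) (α / 2 * n) with ha
    have ha0 : 0 < a := lt_min (mul_pos h12 hnpos) (mul_pos (half_pos hα.1) hnpos)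
    refine IsBigO.of_bound (B / a) (Eventually.of_forall fun T => ?_)
    have hΦ0 : 0 ≤ ∑ k ∈ Finset.range T, (G k + 1 / (n : ℝ) * Dv k) :=
      Finset.sum_nonneg fun k _ =>
        add_nonneg (hG0 k) (mul_nonneg (by positivity) (hDv0 k))
    rw [norm_mul, mul_comm, Real.norm_eq_abs (∑ k ∈ Finset.range T, _), abs_of_nonneg hΦ0]
    refine mul_le_mul_of_nonneg_right ?_ (norm_nonneg _)
    rw [le_div_iff₀ ha0, mul_comm, Finset.mul_sum]
    refine (Finset.sum_le_sum fun k _ => ?_).trans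
      ((le_add_of_nonneg_left ((mul_nonneg hnpos.le (hcost0 T)).trans (hpot T))).trans (hsum T))
    have h1 := mul_le_mul_of_nonneg_right (min_le_left (c₁ * n) (α / 2 * n))
      (mul_nonneg (by positivity : 0 ≤ 1 / (n : ℝ)) (hDv0 k))
    have h2 := mul_le_mul_of_nonneg_right (min_le_right (c₁ * n) (α / 2 * n)) (hG0 k)
    have h3 : c₁ * n * (1 / (n : ℝ) * Dv k) = c₁ * Dv k := by field_simp
    linarith
  · refine IsBigO.of_bound (B / n) (Eventually.of_forall fun T => ?_)
    rw [Real.norm_eq_abs, abs_of_nonneg (hcost0 T), norm_one, mul_one, le_div_iff₀ hnpos, mul_comm]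
    exact ((hpot T).trans (le_add_of_nonneg_right (Finset.sum_nonneg fun k _ => hD0 k))).trans
      (hsum T)
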